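/- For $i\in\{1,\dots,n\}$ let $\mathfrak A'_i$ and $\mathfrak A_i$ be unital C$^*$-algebras, let $\pi'_i:\mathfrak A'_i\to\mathcal B(\mathcal H'_i)$ and $\pi_i:\mathfrak A_i\to\mathcal B(\mathcal H_i)$ be faithful unital $^*$-representations on complex Hilbert spaces, and let $\xi'_i\in\mathcal H'_i$ and $\xi_i\in\mathcal H_i$ be unit vectors. Let $*_{i=1}^n(\mathcal H_i,\xi_i)$ be the free product Hilbert space $$\mathbb C\xi_0\oplus\bigoplus_{m\ge 1}\ \bigoplus_{i_1\ne i_2\ne\cdots\ne i_m}\mathcal H^0_{i_1}\otimes\cdots\otimes\mathcal H^0_{i_m},\qquad \mathcal H_i^0=\mathcal H_i\ominus\mathbb C\xi_i ,$$ let $U_i:\mathcal H_i\otimes\mathcal H(i)\to *_{i=1}^n(\mathcal H_i,\xi_i)$ be the canonical unitary, where $\mathcal H(i)$ is the sum of $\mathbb C\xi_0$ and of the summands with $i_1\neq i$, and let $*_{i=1}^n(\mathfrak A_i,\pi_i,\xi_i)$ be the (unital) C$^*$-subalgebra of $\mathcal B(*_{i=1}^n(\mathcal H_i,\xi_i))$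 generated by the operators $U_i(\pi_i(A)\otimes \mathrm{Id})U_i^*$ with $A\in\mathfrak A_i$, $1\le i\le n$; such an operator is again denoted by $A$. Define $*_{i=1}^n(\mathfrak A'_i,\pi'_i,\xi'_i)$ in the same way. Let $\varphi_i:\mathfrak A'_i\to\mathfrak A_i$ be unital $^*$-homomorphisms such that $$\langle\pi_i(\varphi_i(A))\xi_i,\xi_i\rangle=\langle\pi'_i(A)\xi'_i,\xi'_i\rangle\qquad\text{for all }A\in\mathfrak A'_i,\ 1\le i\le n.$$ Then there is exactly one unital completely positive map $$\Phi:*_{i=1}^n(\mathfrak A'_i,\pi'_i,\xi'_i)\to *_{i=1}^n(\mathfrak A_i,\pi_i,\xi_i)$$ such that $\Phi(A)=\varphi_i(A)$ for all $i$ and all $A\in\mathfrak A'_i$, and $$\Phi(A_1A_2\cdots A_m)=\Phi(A_1)\Phi(A_2)\cdots\Phi(A_m)$$ whenever $m\ge1$, $A_j\in\mathfrak A'_{i_j}$, $\langle\pi'_{i_j}(A_j)\xi'_{i_j},\xi'_{i_j}\rangle=0$ for all $j\in\{1,\dots,m\}$, and $i_j\ne i_{j+1}$ for all $j\in\{1,\dots,m-1\}$;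 and this map $\Phi$ is a unital $^*$-homomorphism. -/

import Mathlib

open scoped TensorProduct InnerProductSpace

universe u v

namespace FreeProd

noncomputable section

/-! ### Hilbert space tensor products -/

/-- The Hilbert space tensor product of `E` and `F`: the completion of the algebraic tensor product
for the inner product with `⟪a ⊗ b, c ⊗ d⟫ = ⟪a, c⟫ * ⟪b, d⟫`. -/
abbrev HTensor (E F : Type*) [NormedAddCommGroup E] [InnerProductSpace ℂ E]
    [NormedAddCommGroup F] [InnerProductSpace ℂ F] : Type _ :=
  UniformSpace.Completion (E ⊗[ℂ] F)

section HTensor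

variable {E E' F : Type*} [NormedAddCommGroup E] [InnerProductSpace ℂ E]
  [NormedAddCommGroup E'] [InnerProductSpace ℂ E'] [NormedAddCommGroup F] [InnerProductSpace ℂ F]

/-- The elementary tensor `x ⊗ y` in the Hilbert space tensor product. -/
def htmul (x : E) (y : F) : HTensor E F := ((x ⊗ₜ[ℂ] y : E ⊗[ℂ] F) : UniformSpace.Completion _)

variable (F) in
/-- The operator `T ⊗ Id` on Hilbert space tensor products. -/
def ampl (T : E →L[ℂ] E') : HTensor E F →L[ℂ] HTensor E' F :=
  (TensorProduct.mapL T (ContinuousLinearMap.id ℂ F)).completion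

theorem ampl_htmul (T : E →L[ℂ] E') (x : E) (y : F) :
    ampl F T (htmul x y) = htmul (T x) y := by
  simp [ampl, htmul]

theorem norm_ampl_le (T : E →L[ℂ] E') : ‖ampl F T‖ ≤ ‖T‖ := by
  refine ContinuousLinearMap.opNorm_le_bound _ (norm_nonneg _) fun x => ?_
  refine UniformSpace.Completion.induction_on x
    (isClosed_le (by fun_prop) (by fun_prop)) fun a => ?_
  rw [ampl, ContinuousLinearMap.completion_apply_coe, UniformSpace.Completion.norm_coe,
    UniformSpace.Completion.norm_coe]
  refine (ContinuousLinearMap.le_opNorm _ _).trans ?_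
  gcongr
  refine (TensorProduct.norm_mapL_le _ _).trans ?_
  calc ‖T‖ * ‖ContinuousLinearMap.id ℂ F‖ ≤ ‖T‖ * 1 := by
        gcongr; exact ContinuousLinearMap.norm_id_le
    _ = ‖T‖ := mul_one _

variable (F) in
/-- The bounded operator `y ↦ x ⊗ y`. -/
def htmulL (x : E) : F →L[ℂ] HTensor E F :=
  UniformSpace.Completion.toComplL.comp (TensorProduct.mkL ℂ E F x)

theorem htmulL_apply (x : E) (y : F) : htmulL F x y = htmul x y := rfl

theorem norm_htmulL_le (x : E) : ‖htmulL F x‖ ≤ ‖x‖ := by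
  refine ContinuousLinearMap.opNorm_le_bound _ (norm_nonneg _) fun y => ?_
  rw [htmulL_apply, htmul, UniformSpace.Completion.norm_coe, TensorProduct.norm_tmul]

end HTensor

/-! ### Maps between `ℓ²`-direct sums -/

section L2

variable {α β : Type*} {E : α → Type*} {F : β → Type*}
  [∀ a, NormedAddCommGroup (E a)] [∀ a, InnerProductSpace ℂ (E a)]
  [∀ b, NormedAddCommGroup (F b)] [∀ b, InnerProductSpace ℂ (F b)]

theorem sum_reindex_le {σ : β → α} (hσ : Function.Injective σ) (T : ∀ b, E (σ b) →L[ℂ] F b)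
    {C : ℝ} (hT : ∀ b, ‖T b‖ ≤ C) (f : lp E 2) (s : Finset β) :
    ∑ b ∈ s, ‖T b (f (σ b))‖ ^ (2 : ENNReal).toReal ≤ (C * ‖f‖) ^ (2 : ENNReal).toReal := by
  classical
  have h2 : (2 : ENNReal).toReal = 2 := by simp
  have hp : 0 < (2 : ENNReal).toReal := by simp
  rcases s.eq_empty_or_nonempty with rfl | ⟨b₀, -⟩
  · rw [Finset.sum_empty, h2, Real.rpow_two]; positivity
  have hC : 0 ≤ C := (norm_nonneg _).trans (hT b₀)
  calc ∑ b ∈ s, ‖T b (f (σ b))‖ ^ (2 : ENNReal).toReal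
      ≤ ∑ b ∈ s, C ^ (2 : ENNReal).toReal * ‖f (σ b)‖ ^ (2 : ENNReal).toReal := by
        refine Finset.sum_le_sum fun b _ => ?_
        rw [← Real.mul_rpow hC (norm_nonneg _)]
        refine Real.rpow_le_rpow (norm_nonneg _) ?_ hp.le
        exact (T b).le_of_opNorm_le (hT b) _
    _ = C ^ (2 : ENNReal).toReal *
          ∑ a ∈ s.map ⟨σ, hσ⟩, ‖f a‖ ^ (2 : ENNReal).toReal := by
        rw [Finset.sum_map, Finset.mul_sum]; rfl
    _ ≤ C ^ (2 : ENNReal).toReal * ‖f‖ ^ (2 : ENNReal).toReal := by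
        gcongr
        exact lp.sum_rpow_le_norm_rpow hp f _
    _ = _ := (Real.mul_rpow hC (norm_nonneg _)).symm

/-- The bounded operator `f ↦ (b ↦ T b (f (σ b)))` between `ℓ²`-direct sums, for an injective map
`σ` of the index sets and operators `T b` of norm at most `C`. -/
def l2Map (σ : β → α) (hσ : Function.Injective σ) (T : ∀ b, E (σ b) →L[ℂ] F b)
    (C : ℝ) (hC : 0 ≤ C) (hT : ∀ b, ‖T b‖ ≤ C) : lp E 2 →L[ℂ] lp F 2 :=
  LinearMap.mkContinuous
    { toFun := fun f => ⟨fun b => T b (f (σ b)), memℓp_gen' (sum_reindex_le hσ T hT f)⟩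
      map_add' := fun f g => by
        ext b
        exact map_add (T b) (f (σ b)) (g (σ b))
      map_smul' := fun c f => by
        ext b
        exact map_smul (T b) c (f (σ b)) }
    C fun f => lp.norm_le_of_forall_sum_le (by simp) (by positivity) (sum_reindex_le hσ T hT f)

theorem l2Map_apply (σ : β → α) (hσ : Function.Injective σ) (T : ∀ b, E (σ b) →L[ℂ] F b)
    (C : ℝ) (hC : 0 ≤ C) (hT : ∀ b, ‖T b‖ ≤ C) (f : lp E 2) (b : β) :
    l2Map σ hσ T C hC hT f b = T b (f (σ b)) := rfl

end L2

/-! ### The free product of Hilbert spaces with distinguished vectors -/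

/-- A bundled complex Hilbert space, used to define word spaces by recursion. -/
structure HilbertSp where
  carrier : Type u
  [normedAddCommGroup : NormedAddCommGroup carrier]
  [innerProductSpace : InnerProductSpace ℂ carrier]
  [completeSpace : CompleteSpace carrier]

attribute [instance] HilbertSp.normedAddCommGroup HilbertSp.innerProductSpace
  HilbertSp.completeSpace

section Words

variable {ι : Type*}

/-- Words `i₁ i₂ … iₙ` (`n ≥ 0`) whose neighbouring letters are different. -/
abbrev AltWord (ι : Type*) : Type _ := {w : List ι // w.IsChain (· ≠ ·)}

/-- Alternating words whose first letter is not `i` (the empty word included). -/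
abbrev AltWordNot (i : ι) : Type _ := {w : AltWord ι // (i :: w.1).IsChain (· ≠ ·)}

/-- The alternating word `i w`, for an alternating word `w` not starting with `i`. -/
abbrev AltWordNot.cons {i : ι} (w : AltWordNot i) : AltWord ι := ⟨i :: w.1.1, w.2⟩

theorem AltWordNot.cons_injective {i : ι} :
    Function.Injective (AltWordNot.cons : AltWordNot i → AltWord ι) := by
  intro w w' h
  have h' : i :: w.1.1 = i :: w'.1.1 := congrArg Subtype.val h
  exact Subtype.ext (Subtype.ext (List.cons.inj h').2)

end Words

section FreeProductSpace

variable {ι : Type*} {H : ι → Type u} [∀ i, NormedAddCommGroup (H i)]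
  [∀ i, InnerProductSpace ℂ (H i)] [∀ i, CompleteSpace (H i)]

/-- `H_i ⊖ ℂ ξ_i`. -/
abbrev Centered (ξ : ∀ i, H i) (i : ι) : Submodule ℂ (H i) := (Submodule.span ℂ {ξ i})ᗮ

/-- The Hilbert space `H°_{i₁} ⊗ H°_{i₂} ⊗ ⋯ ⊗ H°_{iₙ}` of the word `i₁ i₂ … iₙ`, where
`H°_i = H_i ⊖ ℂ ξ_i`; for the empty word it is `ℂ` (in the universe of the `H_i`). -/
def wordSp (ξ : ∀ i, H i) : List ι → HilbertSp.{u}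
  | [] => ⟨EuclideanSpace ℂ PUnit.{u + 1}⟩
  | i :: w => ⟨HTensor (Centered ξ i) (wordSp ξ w).carrier⟩

/-- The underlying type of `wordSp ξ w`. -/
abbrev WordSpace (ξ : ∀ i, H i) (w : List ι) : Type u := (wordSp ξ w).carrier

/-- The identification of `H°_i ⊗ W` with the word space of `i w`, where `W` is the word space
of `w`; both are the same space by definition. -/
def wordCons (ξ : ∀ i, H i) (i : ι) (w : List ι) :
    HTensor (Centered ξ i) (WordSpace ξ w) ≃ₗᵢ[ℂ] WordSpace ξ (i :: w) :=
  LinearIsometryEquiv.refl ℂ (HTensor (Centered ξ i) (WordSpace ξ w))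

/-- The free product `∗ (H_i, ξ_i)`: the Hilbert space direct sum of the word spaces over all
alternating words; the empty word contributes the line spanned by the distinguished vector. -/
abbrev FreeHilbert (ξ : ∀ i, H i) : Type _ := lp (fun w : AltWord ι => WordSpace ξ w.1) 2

/-- `H_i ⊗ H(i)`, where `H(i)` is the direct sum of the word spaces over the alternating words not
starting with `i`; the tensor product is distributed over the direct sum. -/
abbrev LeftSpace (ξ : ∀ i, H i) (i : ι) : Type _ :=
  lp (fun w : AltWordNot i => HTensor (H i) (WordSpace ξ w.1.1)) 2

/-- On the words not starting with `i`, the adjoint of the canonical unitary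
`U_i : H_i ⊗ H(i) → ∗ (H_i, ξ_i)` sends `ζ` to `ξ_i ⊗ ζ`. -/
def unitaryAdjFst (ξ : ∀ i, H i) (i : ι) : FreeHilbert ξ →L[ℂ] LeftSpace ξ i :=
  l2Map (Subtype.val : AltWordNot i → AltWord ι) Subtype.val_injective
    (fun w => htmulL (WordSpace ξ w.1.1) (ξ i)) ‖ξ i‖ (norm_nonneg _) fun _ => norm_htmulL_le _

/-- On the words `i w`, the adjoint of the canonical unitary `U_i` is the inclusion
`H°_i ⊗ W → H_i ⊗ W`, where `W` is the word space of `w`. -/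
def unitaryAdjSnd (ξ : ∀ i, H i) (i : ι) : FreeHilbert ξ →L[ℂ] LeftSpace ξ i :=
  l2Map (AltWordNot.cons : AltWordNot i → AltWord ι) AltWordNot.cons_injective
    (fun w => (ampl (WordSpace ξ w.1.1) (Centered ξ i).subtypeL).comp
      ((wordCons ξ i w.1.1).symm : WordSpace ξ (i :: w.1.1) →L[ℂ]
        HTensor (Centered ξ i) (WordSpace ξ w.1.1)))
    1 zero_le_one fun _ => ContinuousLinearMap.opNorm_le_bound _ zero_le_one fun x =>
      (ContinuousLinearMap.le_of_opNorm_le _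
        ((norm_ampl_le _).trans (Submodule.norm_subtypeL_le _)) _).trans
        (by rw [one_mul, one_mul]; exact ((wordCons ξ i _).symm.norm_map x).le)

/-- The adjoint `U_i^* : ∗ (H_i, ξ_i) → H_i ⊗ H(i)` of the canonical unitary `U_i`. -/
def unitaryAdj (ξ : ∀ i, H i) (i : ι) : FreeHilbert ξ →L[ℂ] LeftSpace ξ i :=
  unitaryAdjFst ξ i + unitaryAdjSnd ξ i

/-- The operator `T ⊗ Id` on `H_i ⊗ H(i)`. -/
def leftAmpl (ξ : ∀ i, H i) (i : ι) (T : H i →L[ℂ] H i) : LeftSpace ξ i →L[ℂ] LeftSpace ξ i :=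
  l2Map id Function.injective_id (fun w => ampl (WordSpace ξ w.1.1) T) ‖T‖ (norm_nonneg _)
    fun _ => norm_ampl_le _

/-- The left action `U_i (T ⊗ Id) U_i^*` of an operator `T` on `H_i` on the free product. -/
def leftAction (ξ : ∀ i, H i) (i : ι) (T : H i →L[ℂ] H i) :
    FreeHilbert ξ →L[ℂ] FreeHilbert ξ :=
  (ContinuousLinearMap.adjoint (unitaryAdj ξ i)).comp ((leftAmpl ξ i T).comp (unitaryAdj ξ i))

end FreeProductSpace

/-! ### The reduced free product of C⋆-algebras -/

section ReducedFreeProduct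

variable {ι : Type*} {A : ι → Type v} [∀ i, CStarAlgebra (A i)]
  {H : ι → Type u} [∀ i, NormedAddCommGroup (H i)]
  [∀ i, InnerProductSpace ℂ (H i)] [∀ i, CompleteSpace (H i)]

/-- The reduced free product `∗ (A_i, π_i, ξ_i)` as the C⋆-subalgebra of the bounded operators on
`∗ (H_i, ξ_i)` generated by the images of the `A_i` under the left actions. -/
def reducedFreeProduct (π : ∀ i, A i →⋆ₐ[ℂ] (H i →L[ℂ] H i)) (ξ : ∀ i, H i) :
    StarSubalgebra ℂ (FreeHilbert ξ →L[ℂ] FreeHilbert ξ) :=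
  (StarAlgebra.adjoin ℂ
    (⋃ i, Set.range fun a : A i => leftAction ξ i (π i a))).topologicalClosure

/-- The reduced free product as a type, carrying its C⋆-algebra structure and its C⋆-order. -/
def ReducedFreeProduct (π : ∀ i, A i →⋆ₐ[ℂ] (H i →L[ℂ] H i)) (ξ : ∀ i, H i) : Type _ :=
  reducedFreeProduct π ξ

variable (π : ∀ i, A i →⋆ₐ[ℂ] (H i →L[ℂ] H i)) (ξ : ∀ i, H i)

theorem isClosed_reducedFreeProduct :
    IsClosed (reducedFreeProduct π ξ : Set (FreeHilbert ξ →L[ℂ] FreeHilbert ξ)) :=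
  StarSubalgebra.isClosed_topologicalClosure _

instance : CStarAlgebra (ReducedFreeProduct π ξ) :=
  haveI : IsClosed (reducedFreeProduct π ξ : Set (FreeHilbert ξ →L[ℂ] FreeHilbert ξ)) :=
    isClosed_reducedFreeProduct π ξ
  inferInstanceAs (CStarAlgebra (reducedFreeProduct π ξ))

instance : PartialOrder (ReducedFreeProduct π ξ) := CStarAlgebra.spectralOrder _

instance : StarOrderedRing (ReducedFreeProduct π ξ) := CStarAlgebra.spectralOrderedRing _

/-- An element `a` of `A_i` regarded as an element of the reduced free product. -/
def incl (i : ι) (a : A i) : ReducedFreeProduct π ξ :=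
  (⟨leftAction ξ i (π i a), StarSubalgebra.le_topologicalClosure _
    (StarAlgebra.subset_adjoin ℂ _ (Set.mem_iUnion.2 ⟨i, a, rfl⟩))⟩ : reducedFreeProduct π ξ)

end ReducedFreeProduct

/-! ### Free products of completely positive maps -/

section FreeProductMap

universe v' u'

variable {ι : Type*}
  {A' : ι → Type v'} [∀ i, CStarAlgebra (A' i)]
  {H' : ι → Type u'} [∀ i, NormedAddCommGroup (H' i)]
  [∀ i, InnerProductSpace ℂ (H' i)] [∀ i, CompleteSpace (H' i)]
  {A : ι → Type v} [∀ i, CStarAlgebra (A i)]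
  {H : ι → Type u} [∀ i, NormedAddCommGroup (H i)]
  [∀ i, InnerProductSpace ℂ (H i)] [∀ i, CompleteSpace (H i)]

/-- `Φ` is the free product of the maps `φ i : A' i → A i`: it is unital and completely positive,
extends every `φ i`, and is multiplicative on alternating products of centered elements.
The list `l` stands for a sequence of pairs `(i_j, a_j)` with `a_j` in `A' i_j`. -/
structure IsFreeProductMap (π' : ∀ i, A' i →⋆ₐ[ℂ] (H' i →L[ℂ] H' i)) (ξ' : ∀ i, H' i)
    (π : ∀ i, A i →⋆ₐ[ℂ] (H i →L[ℂ] H i)) (ξ : ∀ i, H i) (φ : ∀ i, A' i → A i)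
    (Φ : CompletelyPositiveMap (ReducedFreeProduct π' ξ') (ReducedFreeProduct π ξ)) : Prop where
  map_one : Φ 1 = 1
  map_incl : ∀ (i : ι) (a : A' i), Φ (incl π' ξ' i a) = incl π ξ i (φ i a)
  map_alternating : ∀ l : List (Σ i, A' i), l ≠ [] →
    (l.map Sigma.fst).IsChain (· ≠ ·) →
    (∀ p ∈ l, ⟪ξ' p.1, π' p.1 p.2 (ξ' p.1)⟫_ℂ = 0) →
    Φ (l.map fun p => incl π' ξ' p.1 p.2).prod = (l.map fun p => Φ (incl π' ξ' p.1 p.2)).prod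

end FreeProductMap

end

end FreeProd

namespace FreeProd

noncomputable section

/-! ### Elementary tensors and density -/

section HTensorInner

variable {E F : Type*} [NormedAddCommGroup E] [InnerProductSpace ℂ E]
  [NormedAddCommGroup F] [InnerProductSpace ℂ F]

/-! Uniqueness is a density argument. Splitting each letter as `a = (a - τ a • 1) + τ a • 1` and
merging neighbours from the same algebra shows that alternating products of centered elements, with
the empty product 1, span a dense subspace. The conditions on Φ fix it there, and completely
positive maps are continuous.

For existence, let each `A' i` act on both free product spaces, on the second through `π i ∘ φ i`,
and let S be the star algebra generated by the pairs of operators. If `‖p.2‖ ≤ ‖p.1‖` on S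
(`norm_snd_le_norm_fst`), the closure of S is the graph of a star homomorphism over the first
algebra (`exists_starAlgHom_of_norm_snd_le`), which is the required Φ. Working with pairs avoids
assuming in advance that `p.1 ↦ p.2` is well defined.

To prove the inequality, call v bounded if `‖p.2 v‖ ≤ C ‖p.1‖` on S. Bounded vectors form an
S-invariant subspace. The C⋆-identity lets C be replaced by `‖v‖`, so the subspace is closed, and it
suffices that every vector is bounded. The vacuum is bounded because both vacuum functionals agree.
Then induct on word length: if `ξ_i ⊗ z` is bounded, invariance and closedness give `h ⊗ z` for h in
the closed cyclic subspace of `ξ_i`. For h orthogonal to that subspace, `exists_compression` is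
decisive: the compression of `p.1` to the copy of `H'_i` is `π'_i(e)`, and the same e computes the
form of `p.2` at `h ⊗ z`. Faithfulness of `π'_i` gives `‖e‖ ≤ ‖p.1‖`. -/

theorem inner_htmul (x x' : E) (y y' : F) :
    ⟪htmul x y, htmul x' y'⟫_ℂ = ⟪x, x'⟫_ℂ * ⟪y, y'⟫_ℂ := by
  rw [htmul, htmul, UniformSpace.Completion.inner_coe, TensorProduct.inner_tmul]

variable (E) in
/-- The bounded operator `x ↦ x ⊗ y`. -/
def htmulR (y : F) : E →L[ℂ] HTensor E F :=
  UniformSpace.Completion.toComplL.comp ((TensorProduct.mkL ℂ E F).flip y)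

theorem htmulR_apply (x : E) (y : F) : htmulR E y x = htmul x y := rfl

/-- A closed subspace of a Hilbert space tensor product which contains the elementary tensors is
the whole space. -/
theorem mem_of_htmul_mem (M : Submodule ℂ (HTensor E F)) (hM : IsClosed (M : Set (HTensor E F)))
    (h : ∀ x y, htmul x y ∈ M) (t : HTensor E F) : t ∈ M := by
  refine UniformSpace.Completion.induction_on t hM fun a => ?_
  induction a with
  | zero => exact M.zero_mem
  | tmul x y => exact h x y
  | add a b ha hb => rw [UniformSpace.Completion.coe_add]; exact M.add_mem ha hb

/-- The adjoint of inclusion ⊗ Id is projection ⊗ Id; by linearity and continuity in `t`, elementary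
tensors suffice. -/
theorem inner_htmul_ampl_subtypeL (K : Submodule ℂ E) [K.HasOrthogonalProjection] (x : E) (y : F)
    (t : HTensor K F) :
    ⟪htmul x y, ampl F K.subtypeL t⟫_ℂ = ⟪htmul (K.orthogonalProjectionOnto x) y, t⟫_ℂ := by
  refine mem_of_htmul_mem (LinearMap.eqLocus
    ((innerSL ℂ (htmul x y)).comp (ampl F K.subtypeL)).toLinearMap
    (innerSL ℂ (htmul (K.orthogonalProjectionOnto x) y)).toLinearMap)
    (isClosed_eq (by simp only [ContinuousLinearMap.coe_coe]; fun_prop)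
      (by simp only [ContinuousLinearMap.coe_coe]; fun_prop)) (fun k z => ?_) t
  simp [ampl_htmul, inner_htmul]

end HTensorInner

/-! ### Totality of the summands in a direct sum -/

section L2Total

variable {α : Type*} [DecidableEq α] {E : α → Type*}
  [∀ a, NormedAddCommGroup (E a)] [∀ a, InnerProductSpace ℂ (E a)]

/-- A closed subspace of an `ℓ²`-direct sum which contains the summands is the whole space. -/
theorem mem_of_single_mem (M : Submodule ℂ (lp E 2)) (hM : IsClosed (M : Set (lp E 2)))
    (h : ∀ a x, lp.single 2 a x ∈ M) (f : lp E 2) : f ∈ M :=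
  hM.mem_of_tendsto (lp.hasSum_single (by simp) f)
    (Filter.Eventually.of_forall fun s => M.sum_mem fun a _ => h a (f a))

end L2Total

/-! ### The vectors U_i(h ⊗ z) -/

section Place

variable {ι : Type*} {H : ι → Type u} [∀ i, NormedAddCommGroup (H i)]
  [∀ i, InnerProductSpace ℂ (H i)]

open Classical in
/-- The operator `h ↦ U_i (h ⊗ z)`, for `z` in the word space of a word `w` not starting
with `i`. -/
def place (ξ : ∀ i, H i) (i : ι) (w : AltWordNot i) (z : WordSpace ξ w.1.1) :
    H i →L[ℂ] FreeHilbert ξ :=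
  (ContinuousLinearMap.adjoint (unitaryAdj ξ i)).comp
    ((lp.singleContinuousLinearMap ℂ (fun w : AltWordNot i => HTensor (H i) (WordSpace ξ w.1.1))
      2 w).comp (htmulR (H i) z))

variable (ξ : ∀ i, H i) (i : ι) (w : AltWordNot i) (z : WordSpace ξ w.1.1)

open Classical in
theorem place_apply (h : H i) : place ξ i w z h =
    ContinuousLinearMap.adjoint (unitaryAdj ξ i) (lp.single 2 w (htmul h z)) := rfl

theorem unitaryAdj_apply (f : FreeHilbert ξ) : unitaryAdj ξ i f w =
    htmul (ξ i) (f w.1) + ampl (WordSpace ξ w.1.1) (Centered ξ i).subtypeL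
      ((wordCons ξ i w.1.1).symm (f w.cons)) := rfl

/-- Only the adjoint of U_i is given explicitly, so U_i(h ⊗ z) is identified weakly; the two terms
come from the components of h along ξ_i and in H°_i. -/
theorem inner_place (h : H i) (f : FreeHilbert ξ) :
    ⟪place ξ i w z h, f⟫_ℂ = ⟪h, ξ i⟫_ℂ * ⟪z, f w.1⟫_ℂ +
      ⟪wordCons ξ i w.1.1 (htmul ((Centered ξ i).orthogonalProjectionOnto h) z), f w.cons⟫_ℂ := by
  classical
  rw [place_apply, ContinuousLinearMap.adjoint_inner_left, lp.inner_single_left,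
    unitaryAdj_apply, inner_add_right, inner_htmul, inner_htmul_ampl_subtypeL]
  congr 1

open Classical in
theorem place_centered (h : Centered ξ i) : place ξ i w z h =
    lp.single 2 w.cons (wordCons ξ i w.1.1 (htmul h z)) := by
  refine ext_inner_right ℂ fun f => ?_
  rw [inner_place, lp.inner_single_left]
  have : ⟪(h : H i), ξ i⟫_ℂ = 0 :=
    (Submodule.mem_orthogonal' _ _).1 h.2 _ (Submodule.mem_span_singleton_self _)
  simp [this]

open Classical in
theorem place_distinguished (hξ : ‖ξ i‖ = 1) : place ξ i w z (ξ i) = lp.single 2 w.1 z := by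
  refine ext_inner_right ℂ fun f => ?_
  rw [inner_place, lp.inner_single_left]
  have : (Centered ξ i).orthogonalProjectionOnto (ξ i) = 0 := by
    rw [Submodule.orthogonalProjectionOnto_eq_zero_iff]
    exact Submodule.le_orthogonal_orthogonal _ (Submodule.mem_span_singleton_self _)
  have h0 : htmul (0 : Centered ξ i) z = 0 := by simp [htmul]
  simp [this, h0, hξ]

end Place

theorem AltWordNot.val_ne_cons {ι : Type*} {i : ι} (w w' : AltWordNot i) : w.1 ≠ w'.cons := by
  intro h
  have hw := w.2
  rw [congrArg Subtype.val h] at hw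
  exact (List.isChain_cons_cons.1 hw).1 rfl

theorem AltWord.cases_start {ι : Type*} (i : ι) (v : AltWord ι) :
    (∃ w : AltWordNot i, v = w.1) ∨ ∃ w : AltWordNot i, v = w.cons := by
  obtain ⟨v, hv⟩ := v
  cases v with
  | nil => exact Or.inl ⟨⟨⟨[], hv⟩, List.isChain_singleton i⟩, rfl⟩
  | cons j v =>
    by_cases hij : i = j
    · subst hij
      exact Or.inr ⟨⟨⟨v, hv.tail⟩, hv⟩, rfl⟩
    · exact Or.inl ⟨⟨⟨j :: v, hv⟩, List.isChain_cons_cons.2 ⟨hij, hv⟩⟩, rfl⟩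

/-! ### The left actions as star homomorphisms -/

section LeftAction

variable {ι : Type*} {H : ι → Type u} [∀ i, NormedAddCommGroup (H i)]
  [∀ i, InnerProductSpace ℂ (H i)] (ξ : ∀ i, H i) (i : ι)

theorem inner_smul_add_orthogonalProjectionOnto (hξ : ‖ξ i‖ = 1) (h : H i) :
    ⟪ξ i, h⟫_ℂ • ξ i + ((Centered ξ i).orthogonalProjectionOnto h : H i) = h := by
  rw [Submodule.coe_orthogonalProjectionOnto_apply, ← Submodule.starProjection_unit_singleton ℂ hξ]
  exact Submodule.starProjection_add_starProjection_orthogonal h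

/-- A closed subspace of the free product which contains `ξ_i ⊗ z` and `h ⊗ z` for all `h` in
`H°_i` and `z` in the word spaces of words not starting with `i` is the whole space. -/
theorem mem_of_place_mem (hξ : ‖ξ i‖ = 1) (M : Submodule ℂ (FreeHilbert ξ))
    (hM : IsClosed (M : Set (FreeHilbert ξ))) (hp : ∀ w z h, place ξ i w z h ∈ M)
    (f : FreeHilbert ξ) : f ∈ M := by
  classical
  refine mem_of_single_mem M hM (fun v x => ?_) f
  obtain ⟨w, rfl⟩ | ⟨w, rfl⟩ := v.cases_start i
  · rw [← place_distinguished ξ i w x hξ]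
    exact hp _ _ _
  · have key := mem_of_htmul_mem (M.comap ((lp.singleContinuousLinearMap ℂ
      (fun v : AltWord ι => WordSpace ξ v.1) 2 w.cons).comp
        ((wordCons ξ i w.1.1).toContinuousLinearEquiv :
          HTensor (Centered ξ i) (WordSpace ξ w.1.1) →L[ℂ] WordSpace ξ (i :: w.1.1))).toLinearMap)
      (hM.preimage (ContinuousLinearMap.continuous _)) (fun h z => ?_) ((wordCons ξ i w.1.1).symm x)
    · simpa using key
    · have := hp w z h
      rw [place_centered] at this
      simpa using this

theorem ext_place (hξ : ‖ξ i‖ = 1) {X : Type*} [NormedAddCommGroup X] [NormedSpace ℂ X]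
    {S T : FreeHilbert ξ →L[ℂ] X} (h : ∀ w z h, S (place ξ i w z h) = T (place ξ i w z h)) :
    S = T :=
  ContinuousLinearMap.ext fun f => mem_of_place_mem ξ i hξ
    (LinearMap.eqLocus S.toLinearMap T.toLinearMap) (isClosed_eq S.continuous T.continuous) h f

-- The relation U_i^* U_i = Id on elementary tensors. With the totality of the vectors U_i(h ⊗ z),
-- this is all of the unitarity that is needed.
open Classical in
theorem unitaryAdj_place (hξ : ‖ξ i‖ = 1) (w : AltWordNot i) (z : WordSpace ξ w.1.1) (h : H i) :
    unitaryAdj ξ i (place ξ i w z h) = lp.single 2 w (htmul h z) := by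
  -- Both sides are linear in h, which splits into a multiple of ξ_i and a vector of H°_i.
  suffices H : ∀ g : H i, g = ξ i ∨ g ∈ Centered ξ i →
      unitaryAdj ξ i (place ξ i w z g) = lp.single 2 w (htmulR (H i) z g) by
    rw [← htmulR_apply, ← inner_smul_add_orthogonalProjectionOnto ξ i hξ h]
    simp only [map_add, map_smul, lp.single_add, lp.single_smul, H _ (Or.inl rfl),
      H _ (Or.inr (Subtype.mem _))]
  rintro g (rfl | hg)
  · rw [place_distinguished ξ i w z hξ]
    ext1
    funext w'
    rw [unitaryAdj_apply]
    rw [lp.single_apply_ne _ _ _ (AltWordNot.val_ne_cons w w').symm]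
    by_cases hw : w' = w
    · subst hw
      simp [htmulR_apply]
    · rw [lp.single_apply_ne _ _ _ hw, lp.single_apply_ne _ _ _ (Subtype.val_injective.ne hw)]
      simp [htmul]
  · rw [place_centered ξ i w z ⟨g, hg⟩]
    ext1
    funext w'
    rw [unitaryAdj_apply]
    rw [lp.single_apply_ne _ _ _ (AltWordNot.val_ne_cons w' w)]
    by_cases hw : w' = w
    · subst hw
      have h0 : htmul (ξ i) (0 : WordSpace ξ w'.1.1) = 0 := by simp [htmul]
      rw [h0, zero_add, lp.single_apply_self, lp.single_apply_self,
        LinearIsometryEquiv.symm_apply_apply, ampl_htmul]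
      rfl
    · rw [lp.single_apply_ne _ _ _ hw,
        lp.single_apply_ne _ _ _ (AltWordNot.cons_injective.ne hw)]
      simp [htmul]

theorem leftAmpl_apply (T : H i →L[ℂ] H i) (f : LeftSpace ξ i) (w : AltWordNot i) :
    leftAmpl ξ i T f w = ampl (WordSpace ξ w.1.1) T (f w) := rfl

/-- The operator touches only the first leg. Since the vectors U_i(h ⊗ z) are total, every algebraic
identity for left actions reduces to this formula. -/
theorem leftAction_place (hξ : ‖ξ i‖ = 1) (T : H i →L[ℂ] H i) (w : AltWordNot i)
    (z : WordSpace ξ w.1.1) (h : H i) :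
    leftAction ξ i T (place ξ i w z h) = place ξ i w z (T h) := by
  classical
  rw [leftAction, ContinuousLinearMap.comp_apply, ContinuousLinearMap.comp_apply,
    unitaryAdj_place ξ i hξ, place_apply]
  congr 1
  ext1
  funext w'
  rw [leftAmpl_apply]
  by_cases hw : w' = w
  · subst hw
    simp [ampl_htmul]
  · rw [lp.single_apply_ne _ _ _ hw, lp.single_apply_ne _ _ _ hw, map_zero]

theorem inner_place_place (hξ : ‖ξ i‖ = 1) (w : AltWordNot i) (z z' : WordSpace ξ w.1.1)
    (h h' : H i) :
    ⟪place ξ i w z h, place ξ i w z' h'⟫_ℂ = ⟪h, h'⟫_ℂ * ⟪z, z'⟫_ℂ := by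
  classical
  rw [place_apply, ContinuousLinearMap.adjoint_inner_left, unitaryAdj_place ξ i hξ,
    lp.inner_single_left, lp.single_apply_self, inner_htmul]

theorem norm_place (hξ : ‖ξ i‖ = 1) (w : AltWordNot i) (z : WordSpace ξ w.1.1) (h : H i) :
    ‖place ξ i w z h‖ = ‖h‖ * ‖z‖ := by
  have := inner_place_place ξ i hξ w z z h h
  simp only [inner_self_eq_norm_sq_to_K] at this
  norm_cast at this
  rw [← mul_pow] at this
  exact (sq_eq_sq₀ (norm_nonneg _) (by positivity)).1 (by exact_mod_cast this)

theorem inner_place_of_ne (hξ : ‖ξ i‖ = 1) {w w' : AltWordNot i} (hw : w ≠ w')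
    (z : WordSpace ξ w.1.1) (z' : WordSpace ξ w'.1.1) (h h' : H i) :
    ⟪place ξ i w z h, place ξ i w' z' h'⟫_ℂ = 0 := by
  classical
  rw [place_apply, ContinuousLinearMap.adjoint_inner_left, unitaryAdj_place ξ i hξ,
    lp.inner_single_left, lp.single_apply_ne _ _ _ hw, inner_zero_right]

variable [∀ i, CompleteSpace (H i)]

theorem adjoint_leftAction (hξ : ‖ξ i‖ = 1) (T : H i →L[ℂ] H i) :
    leftAction ξ i (ContinuousLinearMap.adjoint T) =
      ContinuousLinearMap.adjoint (leftAction ξ i T) := by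
  refine ext_place ξ i hξ fun w z h => ?_
  -- The difference d of the two vectors vanishes once the functional ⟪d, ·⟫ does, and this
  -- functional is tested on the total set of placed vectors.
  rw [← sub_eq_zero, ← inner_self_eq_zero (𝕜 := ℂ)]
  have key := ext_place ξ i hξ
    (S := (innerSL ℂ (leftAction ξ i (ContinuousLinearMap.adjoint T) (place ξ i w z h) -
      ContinuousLinearMap.adjoint (leftAction ξ i T) (place ξ i w z h)))) (T := 0)
    fun w' z' h' => ?_
  · exact DFunLike.congr_fun key _
  · rw [innerSL_apply_apply, inner_sub_left, ContinuousLinearMap.adjoint_inner_left,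
      leftAction_place ξ i hξ, leftAction_place ξ i hξ, zero_apply, sub_eq_zero]
    by_cases hw : w = w'
    · subst hw
      rw [inner_place_place ξ i hξ, inner_place_place ξ i hξ,
        ContinuousLinearMap.adjoint_inner_left]
    · rw [inner_place_of_ne ξ i hξ hw, inner_place_of_ne ξ i hξ hw]

/-- The left action `T ↦ U_i (T ⊗ Id) U_i^*` as a star homomorphism. -/
def leftActionHom (hξ : ‖ξ i‖ = 1) :
    (H i →L[ℂ] H i) →⋆ₐ[ℂ] (FreeHilbert ξ →L[ℂ] FreeHilbert ξ) where
  toFun := leftAction ξ i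
  map_one' := ext_place ξ i hξ fun w z h => by
    rw [leftAction_place ξ i hξ]; rfl
  map_mul' S T := ext_place ξ i hξ fun w z h => by
    simp [leftAction_place ξ i hξ]
  map_zero' := ext_place ξ i hξ fun w z h => by
    simp [leftAction_place ξ i hξ]
  map_add' S T := ext_place ξ i hξ fun w z h => by
    simp [leftAction_place ξ i hξ]
  commutes' c := ext_place ξ i hξ fun w z h => by
    simp [leftAction_place ξ i hξ, Algebra.algebraMap_eq_smul_one]
  map_star' T := adjoint_leftAction ξ i hξ T

end LeftAction

/-! ### Alternating centered products span the generated algebra -/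

section AlternatingSpan

variable {ι : Type*} {A : ι → Type*}

/-- The words in elements of the `A i` with neighbouring letters from different algebras and all
letters in the kernels of the `τ i`. -/
structure IsAltCentered (τ : ∀ i, A i → ℂ) (l : List (Σ i, A i)) : Prop where
  isChain : (l.map Sigma.fst).IsChain (· ≠ ·)
  centered : ∀ p ∈ l, τ p.1 p.2 = 0

theorem IsAltCentered.nil (τ : ∀ i, A i → ℂ) : IsAltCentered τ [] := ⟨List.isChain_nil, by simp⟩

theorem IsAltCentered.of_append_left {τ : ∀ i, A i → ℂ} {l l' : List (Σ i, A i)}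
    (h : IsAltCentered τ (l ++ l')) : IsAltCentered τ l where
  isChain := (List.isChain_append.1 (List.map_append ▸ h.isChain)).1
  centered p hp := h.centered p (List.mem_append_left _ hp)

theorem IsAltCentered.tail {τ : ∀ i, A i → ℂ} {p : Σ i, A i} {l : List (Σ i, A i)}
    (h : IsAltCentered τ (p :: l)) : IsAltCentered τ l where
  isChain := List.IsChain.tail h.isChain
  centered q hq := h.centered q (List.mem_cons_of_mem _ hq)

/-- The span of the products of alternating centered words. -/
def altSpan {B : Type*} [Ring B] [Algebra ℂ B] (τ : ∀ i, A i → ℂ) (j : ∀ i, A i → B) :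
    Submodule ℂ B :=
  Submodule.span ℂ {b | ∃ l, IsAltCentered τ l ∧ b = (l.map fun p => j p.1 p.2).prod}

variable [∀ i, Ring (A i)] [∀ i, Algebra ℂ (A i)] {B : Type*} [Ring B] [Algebra ℂ B]
  (τ : ∀ i, A i →ₗ[ℂ] ℂ) (j : ∀ i, A i →ₐ[ℂ] B)

theorem prod_mem_altSpan {l : List (Σ i, A i)} (hl : IsAltCentered (fun i => τ i) l) :
    (l.map fun p => j p.1 p.2).prod ∈ altSpan (fun i => τ i) (fun i => j i) :=
  Submodule.subset_span ⟨l, hl, rfl⟩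

/-- Write `a` as its centered part plus a scalar: the first lengthens the word, the second leaves it
unchanged. -/
theorem mul_prod_mem_altSpan_of_isChain (hτ : ∀ i, τ i 1 = 1) (i : ι) (a : A i)
    {l : List (Σ i, A i)} (hl : IsAltCentered (fun i => τ i) l)
    (hi : (i :: l.map Sigma.fst).IsChain (· ≠ ·)) :
    j i a * (l.map fun p => j p.1 p.2).prod ∈ altSpan (fun i => τ i) (fun i => j i) := by
  have h1 : IsAltCentered (fun i => τ i) (⟨i, a - τ i a • 1⟩ :: l) := by
    refine ⟨hi, fun p hp => ?_⟩
    rcases List.mem_cons.1 hp with rfl | hp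
    · simp [hτ]
    · exact hl.centered p hp
  have h2 : j i a * (l.map fun p => j p.1 p.2).prod =
      (((⟨i, a - τ i a • 1⟩ : Σ i, A i) :: l).map fun p => j p.1 p.2).prod +
        τ i a • (l.map fun p => j p.1 p.2).prod := by
    simp [sub_mul]
  rw [h2]
  exact add_mem (prod_mem_altSpan τ j h1) (Submodule.smul_mem _ _ (prod_mem_altSpan τ j hl))

theorem mul_prod_mem_altSpan (hτ : ∀ i, τ i 1 = 1) (i : ι) (a : A i)
    {l : List (Σ i, A i)} (hl : IsAltCentered (fun i => τ i) l) :
    j i a * (l.map fun p => j p.1 p.2).prod ∈ altSpan (fun i => τ i) (fun i => j i) := by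
  rcases l with _ | ⟨⟨k, b⟩, l⟩
  · exact mul_prod_mem_altSpan_of_isChain τ j hτ i a hl (List.isChain_singleton i)
  · by_cases hik : i = k
    · subst hik
      rw [List.map_cons, List.prod_cons, ← mul_assoc, ← map_mul]
      exact mul_prod_mem_altSpan_of_isChain τ j hτ i (a * b) hl.tail hl.isChain
    · exact mul_prod_mem_altSpan_of_isChain τ j hτ i a hl
        (List.isChain_cons_cons.2 ⟨hik, hl.isChain⟩)

/-- The span contains 1 and is stable under left multiplication by the generators. -/
theorem adjoin_le_altSpan (hτ : ∀ i, τ i 1 = 1) :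
    Subalgebra.toSubmodule (Algebra.adjoin ℂ (⋃ i, Set.range (j i))) ≤
      altSpan (fun i => τ i) (fun i => j i) := by
  rw [Algebra.adjoin_eq_span, Submodule.span_le]
  intro b hb
  induction hb using Submonoid.closure_induction_left with
  | one => exact Submodule.subset_span ⟨[], IsAltCentered.nil _, by simp⟩
  | mul_left x hx y _ hy =>
    obtain ⟨i, a, rfl⟩ := Set.mem_iUnion.1 hx
    have : altSpan (fun i => τ i) (fun i => j i) ≤
        (altSpan (fun i => τ i) (fun i => j i)).comap (LinearMap.mulLeft ℂ (j i a)) :=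
      Submodule.span_le.2 fun b ⟨l, hl, hb⟩ => hb ▸ mul_prod_mem_altSpan τ j hτ i a hl
    exact this hy

theorem starAdjoin_le_altSpan {A : ι → Type*} [∀ i, Ring (A i)] [∀ i, StarRing (A i)]
    [∀ i, Algebra ℂ (A i)] [∀ i, StarModule ℂ (A i)] [StarRing B] [StarModule ℂ B]
    (τ : ∀ i, A i →ₗ[ℂ] ℂ) (hτ : ∀ i, τ i 1 = 1) (j : ∀ i, A i →⋆ₐ[ℂ] B) {b : B}
    (hb : b ∈ StarAlgebra.adjoin ℂ (⋃ i, Set.range (j i))) :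
    b ∈ altSpan (fun i => τ i) (fun i => j i) := by
  have hs : star (⋃ i, Set.range (j i)) = ⋃ i, Set.range (j i) := by
    ext b
    simp only [Set.mem_star, Set.mem_iUnion, Set.mem_range]
    exact exists_congr fun i => ⟨fun ⟨a, ha⟩ => ⟨star a, by rw [map_star, ha, star_star]⟩,
      fun ⟨a, ha⟩ => ⟨star a, by rw [map_star, ha]⟩⟩
  have hb' : b ∈ (StarAlgebra.adjoin ℂ (⋃ i, Set.range (j i))).toSubalgebra := hb
  rw [StarAlgebra.adjoin_toSubalgebra, hs, Set.union_self] at hb'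
  exact adjoin_le_altSpan τ (fun i => (j i).toAlgHom) hτ hb'

end AlternatingSpan

/-! ### How centered words move the summands -/

section Support

variable {ι : Type*} {H : ι → Type u} [∀ i, NormedAddCommGroup (H i)]
  [∀ i, InnerProductSpace ℂ (H i)] {ξ : ∀ i, H i}

/-- The vectors of the free product which lie in the summand of the word `v`. -/
def SupportedOn (v : List ι) (f : FreeHilbert ξ) : Prop :=
  ∀ w : AltWord ι, w.1 ≠ v → f w = 0

open Classical in
theorem supportedOn_single (w : AltWord ι) (z : WordSpace ξ w.1) :
    SupportedOn w.1 (lp.single 2 w z : FreeHilbert ξ) := fun _ hv =>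
  lp.single_apply_ne _ _ _ fun h => hv (congrArg Subtype.val h)

open Classical in
theorem SupportedOn.eq_single {w : AltWord ι} {f : FreeHilbert ξ} (hf : SupportedOn w.1 f) :
    f = lp.single 2 w (f w) := by
  ext1
  funext v
  by_cases hv : v = w
  · subst hv
    rw [lp.single_apply_self]
  · rw [lp.single_apply_ne _ _ _ hv, hf v (Subtype.val_injective.ne hv)]

theorem SupportedOn.inner_eq_zero {v v' : List ι} {f g : FreeHilbert ξ} (hf : SupportedOn v f)
    (hg : SupportedOn v' g) (h : v ≠ v') : ⟪f, g⟫_ℂ = 0 := by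
  rw [lp.inner_eq_tsum]
  refine (tsum_congr fun w => ?_).trans tsum_zero
  by_cases hw : w.1 = v
  · rw [hg w (hw ▸ h), inner_zero_right]
  · rw [hf w hw, inner_zero_left]

theorem mem_centered_iff {i : ι} {h : H i} : h ∈ Centered ξ i ↔ ⟪ξ i, h⟫_ℂ = 0 :=
  Submodule.mem_orthogonal_singleton_iff_inner_right

theorem supportedOn_place {i : ι} (w : AltWordNot i) (z : WordSpace ξ w.1.1) {h : H i}
    (hh : h ∈ Centered ξ i) : SupportedOn (i :: w.1.1) (place ξ i w z h) := by
  classical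
  rw [place_centered ξ i w z ⟨h, hh⟩]
  exact supportedOn_single w.cons _

/-- Since `w` does not start with `i`, f equals U_i(ξ_i ⊗ f_w) and goes to U_i(Tξ_i ⊗ f_w); the
hypothesis puts Tξ_i in H°_i, so one letter is created. -/
theorem SupportedOn.leftAction {i : ι} (hξ : ‖ξ i‖ = 1) {T : H i →L[ℂ] H i}
    (hT : ⟪ξ i, T (ξ i)⟫_ℂ = 0) {w : List ι} (hw : (i :: w).IsChain (· ≠ ·)) {f : FreeHilbert ξ}
    (hf : SupportedOn w f) : SupportedOn (i :: w) (leftAction ξ i T f) := by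
  classical
  let w' : AltWordNot i := ⟨⟨w, hw.tail⟩, hw⟩
  rw [SupportedOn.eq_single (w := w'.1) hf, ← place_distinguished ξ i w' _ hξ,
    leftAction_place ξ i hξ]
  exact supportedOn_place w' _ (mem_centered_iff.2 hT)

variable {A : ι → Type*} [∀ i, CStarAlgebra (A i)] [∀ i, CompleteSpace (H i)]
  {π : ∀ i, A i →⋆ₐ[ℂ] (H i →L[ℂ] H i)}

theorem SupportedOn.prod (hξ : ∀ i, ‖ξ i‖ = 1) {l : List (Σ i, A i)}
    (hl : ∀ p ∈ l, ⟪ξ p.1, π p.1 p.2 (ξ p.1)⟫_ℂ = 0) {v : List ι}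
    (hv : (l.map Sigma.fst ++ v).IsChain (· ≠ ·)) {f : FreeHilbert ξ} (hf : SupportedOn v f) :
    SupportedOn (l.map Sigma.fst ++ v)
      ((l.map fun p => FreeProd.leftAction ξ p.1 (π p.1 p.2)).prod f) := by
  induction l with
  | nil => exact hf
  | cons p l ih =>
    simp only [List.map_cons, List.prod_cons, List.cons_append, mul_apply_eq_comp]
    exact (ih (fun q hq => hl q (List.mem_cons_of_mem _ hq)) (List.IsChain.tail hv)).leftAction
      (hξ _) (hl p List.mem_cons_self) hv

/-- A nonempty alternating centered word not ending with `i` has vanishing compression to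
`H°_i ⊗ z`. -/
theorem inner_place_prod_place_eq_zero (hξ : ∀ i, ‖ξ i‖ = 1) {l : List (Σ i, A i)}
    (hl : ∀ p ∈ l, ⟪ξ p.1, π p.1 p.2 (ξ p.1)⟫_ℂ = 0) (hne : l ≠ []) {i : ι}
    (hi : (l.map Sigma.fst ++ [i]).IsChain (· ≠ ·)) (w : AltWordNot i) (z : WordSpace ξ w.1.1)
    {h h' : H i} (hh : h ∈ Centered ξ i) (hh' : h' ∈ Centered ξ i) :
    ⟪place ξ i w z h, (l.map fun p => FreeProd.leftAction ξ p.1 (π p.1 p.2)).prod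
      (place ξ i w z h')⟫_ℂ = 0 := by
  refine (supportedOn_place w z hh).inner_eq_zero ((supportedOn_place w z hh').prod hξ hl
    (List.isChain_split.2 ⟨hi, w.2⟩)) fun H => hne ?_
  have := congrArg List.length H
  rw [List.length_append, List.length_map] at this
  exact List.eq_nil_of_length_eq_zero (by omega)

/-- The empty word, as a word not starting with `i`. -/
def emptyWord (i : ι) : AltWordNot i := ⟨⟨[], List.isChain_nil⟩, List.isChain_singleton i⟩

/-- A nonempty alternating centered word not ending with `i` has vanishing compression to `H_i`. -/
theorem inner_place_emptyWord_prod_place_eq_zero (hξ : ∀ i, ‖ξ i‖ = 1) {l : List (Σ i, A i)}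
    (hl : ∀ p ∈ l, ⟪ξ p.1, π p.1 p.2 (ξ p.1)⟫_ℂ = 0) (hne : l ≠ []) {i : ι}
    (hi : (l.map Sigma.fst ++ [i]).IsChain (· ≠ ·)) (z : WordSpace ξ (emptyWord i).1.1)
    (h h' : H i) :
    ⟪place ξ i (emptyWord i) z h, (l.map fun p => FreeProd.leftAction ξ p.1 (π p.1 p.2)).prod
      (place ξ i (emptyWord i) z h')⟫_ℂ = 0 := by
  have h0 : SupportedOn [] (place ξ i (emptyWord i) z (ξ i)) := by
    classical
    rw [place_distinguished ξ i (emptyWord i) z (hξ i)]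
    exact supportedOn_single (emptyWord i).1 z
  have hch : (l.map Sigma.fst ++ []).IsChain (· ≠ ·) := by
    rw [List.append_nil]; exact (List.isChain_append.1 hi).1
  have h1 : ∀ g ∈ Centered ξ i, SupportedOn [i] (place ξ i (emptyWord i) z g) := fun g hg =>
    supportedOn_place (emptyWord i) z hg
  have hne' : l.map Sigma.fst ≠ [] := fun h => hne (List.map_eq_nil_iff.1 h)
  have h00 : [] ≠ l.map Sigma.fst ++ [] := fun H => hne' (List.append_eq_nil_iff.1 H.symm).1
  -- If `l` were the one-letter word `i`, then `l i` would be `i i`, which is not alternating.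
  have h10 : [i] ≠ l.map Sigma.fst ++ [] := fun H => by
    rw [List.append_nil] at H
    rw [← H] at hi
    simp at hi
  have h01 : [] ≠ l.map Sigma.fst ++ [i] := fun H => hne' (List.append_eq_nil_iff.1 H.symm).1
  have h11 : [i] ≠ l.map Sigma.fst ++ [i] := fun H => hne' (List.self_eq_append_left.1 H)
  rw [← inner_smul_add_orthogonalProjectionOnto ξ i (hξ i) h,
    ← inner_smul_add_orthogonalProjectionOnto ξ i (hξ i) h']
  have hp := ((Centered ξ i).orthogonalProjectionOnto h).2
  have hp' := ((Centered ξ i).orthogonalProjectionOnto h').2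
  simp only [map_add, map_smul, inner_add_left, inner_add_right, inner_smul_left, inner_smul_right]
  rw [h0.inner_eq_zero (h0.prod hξ hl hch) h00, (h1 _ hp).inner_eq_zero (h0.prod hξ hl hch) h10,
    h0.inner_eq_zero ((h1 _ hp').prod hξ hl hi) h01,
    (h1 _ hp).inner_eq_zero ((h1 _ hp').prod hξ hl hi) h11]
  simp

end Support

/-! ### Vectors on which the second coordinate is dominated by the first -/

section BoundedVectors

variable {B : Type*} [CStarAlgebra B] {K : Type*} [NormedAddCommGroup K] [InnerProductSpace ℂ K]
  [CompleteSpace K] (S : StarSubalgebra ℂ (B × (K →L[ℂ] K)))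

theorem norm_apply_sq_le (v : K) (p : B × (K →L[ℂ] K)) :
    ‖p.2 v‖ ^ 2 ≤ ‖⟪v, (star p * p).2 v⟫_ℂ‖ := by
  have : ⟪v, (star p * p).2 v⟫_ℂ = ⟪p.2 v, p.2 v⟫_ℂ := by
    change ⟪v, (ContinuousLinearMap.adjoint p.2) (p.2 v)⟫_ℂ = _
    rw [ContinuousLinearMap.adjoint_inner_right]
  rw [this, inner_self_eq_norm_sq_to_K, norm_pow]
  simp

/-- The vectors `v` for which `y v` is dominated by `x` for all pairs `(x, y)` in `S`. -/
def boundedVectors : Submodule ℂ K where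
  carrier := {v | ∃ C : ℝ, ∀ p ∈ S, ‖p.2 v‖ ≤ C * ‖p.1‖}
  zero_mem' := ⟨0, fun p _ => by simp⟩
  add_mem' := by
    rintro v w ⟨C, hC⟩ ⟨D, hD⟩
    refine ⟨C + D, fun p hp => ?_⟩
    rw [map_add, add_mul]
    exact (norm_add_le _ _).trans (add_le_add (hC p hp) (hD p hp))
  smul_mem' := by
    rintro c v ⟨C, hC⟩
    refine ⟨‖c‖ * C, fun p hp => ?_⟩
    rw [map_smul, norm_smul, mul_assoc]
    exact mul_le_mul_of_nonneg_left (hC p hp) (norm_nonneg _)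

variable {S}

/-- Applying the quadratic bound to `star p * p` and using the C⋆-identity gives ‖p.2 v‖² ≤ C
‖p.1‖², hence the constant √C. -/
theorem mem_boundedVectors_of_inner {v : K} {C : ℝ}
    (h : ∀ p ∈ S, ‖⟪v, p.2 v⟫_ℂ‖ ≤ C * ‖p.1‖) : v ∈ boundedVectors S := by
  refine ⟨√C, fun p hp => ?_⟩
  have hC : 0 ≤ C ∨ ‖p.1‖ = 0 := by
    rcases (norm_nonneg p.1).eq_or_lt with h0 | h0
    · exact Or.inr h0.symm
    · exact Or.inl (nonneg_of_mul_nonneg_left ((norm_nonneg _).trans (h p hp)) h0)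
  have h1 : ‖p.2 v‖ ^ 2 ≤ C * ‖p.1‖ ^ 2 := by
    refine (norm_apply_sq_le v p).trans ((h _ (mul_mem (star_mem hp) hp)).trans_eq ?_)
    rw [Prod.fst_mul, Prod.fst_star, CStarRing.norm_star_mul_self, sq]
  refine abs_le_of_sq_le_sq' ?_ (by positivity) |>.2
  rcases hC with hC | hC
  · rwa [mul_pow, Real.sq_sqrt hC]
  · simpa [hC] using h1

/-- The constant in the definition of `boundedVectors` can be taken to be the norm. -/
theorem norm_apply_le_of_mem_boundedVectors {v : K} (hv : v ∈ boundedVectors S)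
    {p : B × (K →L[ℂ] K)} (hp : p ∈ S) : ‖p.2 v‖ ≤ ‖v‖ * ‖p.1‖ := by
  let T : Set ℝ := {C | 0 ≤ C ∧ ∀ p ∈ S, ‖p.2 v‖ ≤ C * ‖p.1‖}
  have hT : T.Nonempty := by
    obtain ⟨C, hC⟩ := hv
    exact ⟨|C|, abs_nonneg C, fun p hp => (hC p hp).trans
      (mul_le_mul_of_nonneg_right (le_abs_self C) (norm_nonneg _))⟩
  have hbdd : BddBelow T := ⟨0, fun C hC => hC.1⟩
  have h0 : 0 ≤ sInf T := Real.sInf_nonneg fun C hC => hC.1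
  have hinf : ∀ p ∈ S, ‖p.2 v‖ ≤ sInf T * ‖p.1‖ := by
    intro p hp
    rcases (norm_nonneg p.1).eq_or_lt with hp0 | hp0
    · obtain ⟨C, -, hC⟩ := hT
      have := hC p hp
      rwa [← hp0, mul_zero] at this ⊢
    · rw [← div_le_iff₀ hp0]
      exact le_csInf hT fun C hC => (div_le_iff₀ hp0).2 (hC.2 p hp)
  -- Self-improvement: an admissible constant c yields √(‖v‖ c) through `star p * p`. For the
  -- infimum m this gives m ≤ √(‖v‖ m), that is, m ≤ ‖v‖.
  have hsq : √(‖v‖ * sInf T) ∈ T := by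
    refine ⟨Real.sqrt_nonneg _, fun p hp => abs_le_of_sq_le_sq' ?_ (by positivity) |>.2⟩
    rw [mul_pow, Real.sq_sqrt (by positivity)]
    calc ‖p.2 v‖ ^ 2 ≤ ‖⟪v, (star p * p).2 v⟫_ℂ‖ := norm_apply_sq_le v p
      _ ≤ ‖v‖ * ‖(star p * p).2 v‖ := norm_inner_le_norm _ _
      _ ≤ ‖v‖ * (sInf T * ‖(star p * p).1‖) := by
        gcongr; exact hinf _ (mul_mem (star_mem hp) hp)
      _ = ‖v‖ * sInf T * ‖p.1‖ ^ 2 := by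
        rw [Prod.fst_mul, Prod.fst_star, CStarRing.norm_star_mul_self]; ring
  have hle : sInf T ≤ ‖v‖ := by
    rcases h0.eq_or_lt with h | h
    · rw [← h]; exact norm_nonneg v
    · refine le_of_mul_le_mul_right ?_ h
      have := csInf_le hbdd hsq
      rwa [Real.le_sqrt h0 (by positivity), sq] at this
  exact (hinf p hp).trans (mul_le_mul_of_nonneg_right hle (norm_nonneg _))

/-- The uniform constant ‖v‖ turns an existential condition into an intersection of closed ones. -/
theorem isClosed_boundedVectors : IsClosed (boundedVectors S : Set K) := by
  have : (boundedVectors S : Set K) = ⋂ p ∈ S, {v | ‖p.2 v‖ ≤ ‖v‖ * ‖p.1‖} := by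
    ext v
    simp only [Set.mem_iInter, Set.mem_ofPred_eq, SetLike.mem_coe]
    exact ⟨fun hv p hp => norm_apply_le_of_mem_boundedVectors hv hp, fun h => ⟨‖v‖, h⟩⟩
  rw [this]
  exact isClosed_biInter fun p _ => isClosed_le (by fun_prop) (by fun_prop)

theorem apply_mem_boundedVectors {v : K} (hv : v ∈ boundedVectors S) {p : B × (K →L[ℂ] K)}
    (hp : p ∈ S) : p.2 v ∈ boundedVectors S := by
  refine ⟨‖v‖ * ‖p.1‖, fun q hq => ?_⟩
  calc ‖q.2 (p.2 v)‖ ≤ ‖v‖ * ‖q.1 * p.1‖ :=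
        norm_apply_le_of_mem_boundedVectors hv (mul_mem hq hp)
    _ ≤ ‖v‖ * (‖q.1‖ * ‖p.1‖) := by gcongr; exact norm_mul_le _ _
    _ = ‖v‖ * ‖p.1‖ * ‖q.1‖ := by ring

end BoundedVectors

/-! ### One family of algebras acting on two free products: matrix coefficients -/

section Comparison

universe u'

variable {ι : Type*} {A : ι → Type*} [∀ i, CStarAlgebra (A i)]
  {H' : ι → Type u'} [∀ i, NormedAddCommGroup (H' i)]
  [∀ i, InnerProductSpace ℂ (H' i)] [∀ i, CompleteSpace (H' i)]
  {H : ι → Type u} [∀ i, NormedAddCommGroup (H i)]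
  [∀ i, InnerProductSpace ℂ (H i)] [∀ i, CompleteSpace (H i)]
  {π' : ∀ i, A i →⋆ₐ[ℂ] (H' i →L[ℂ] H' i)} {ξ' : ∀ i, H' i}
  {π : ∀ i, A i →⋆ₐ[ℂ] (H i →L[ℂ] H i)} {ξ : ∀ i, H i}

/-- The vector functional `a ↦ ⟨π_i(a) ξ_i, ξ_i⟩`. -/
def vecState (π : ∀ i, A i →⋆ₐ[ℂ] (H i →L[ℂ] H i)) (ξ : ∀ i, H i) (i : ι) : A i →ₗ[ℂ] ℂ where
  toFun a := ⟪ξ i, π i a (ξ i)⟫_ℂ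
  map_add' a b := by simp
  map_smul' c a := by simp

theorem vecState_apply (i : ι) (a : A i) : vecState π ξ i a = ⟪ξ i, π i a (ξ i)⟫_ℂ := rfl

theorem vecState_one (hξ : ∀ i, ‖ξ i‖ = 1) (i : ι) : vecState π ξ i 1 = 1 := by
  simp [vecState_apply, hξ]

/-- The action of `A i` on the two free products of Hilbert spaces. -/
def pairHom (π' : ∀ i, A i →⋆ₐ[ℂ] (H' i →L[ℂ] H' i)) (hξ' : ∀ i, ‖ξ' i‖ = 1)
    (π : ∀ i, A i →⋆ₐ[ℂ] (H i →L[ℂ] H i)) (hξ : ∀ i, ‖ξ i‖ = 1) (i : ι) :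
    A i →⋆ₐ[ℂ] (FreeHilbert ξ' →L[ℂ] FreeHilbert ξ') × (FreeHilbert ξ →L[ℂ] FreeHilbert ξ) :=
  ((leftActionHom ξ' i (hξ' i)).comp (π' i)).prod ((leftActionHom ξ i (hξ i)).comp (π i))

theorem pairHom_apply (hξ' : ∀ i, ‖ξ' i‖ = 1) (hξ : ∀ i, ‖ξ i‖ = 1) (i : ι) (a : A i) :
    pairHom π' hξ' π hξ i a = (leftAction ξ' i (π' i a), leftAction ξ i (π i a)) := rfl

theorem prod_pairHom (hξ' : ∀ i, ‖ξ' i‖ = 1) (hξ : ∀ i, ‖ξ i‖ = 1) (l : List (Σ i, A i)) :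
    (l.map fun p => pairHom π' hξ' π hξ p.1 p.2).prod =
      ((l.map fun p => leftAction ξ' p.1 (π' p.1 p.2)).prod,
        (l.map fun p => leftAction ξ p.1 (π p.1 p.2)).prod) := by
  induction l with
  | nil => rfl
  | cons p l ih =>
    simp only [List.map_cons, List.prod_cons]
    rw [ih]
    rfl

/-- The star algebra generated by the pairs of the actions of the elements of the `A i`. -/
def pairAlgebra (π' : ∀ i, A i →⋆ₐ[ℂ] (H' i →L[ℂ] H' i)) (hξ' : ∀ i, ‖ξ' i‖ = 1)
    (π : ∀ i, A i →⋆ₐ[ℂ] (H i →L[ℂ] H i)) (hξ : ∀ i, ‖ξ i‖ = 1) :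
    StarSubalgebra ℂ
      ((FreeHilbert ξ' →L[ℂ] FreeHilbert ξ') × (FreeHilbert ξ →L[ℂ] FreeHilbert ξ)) :=
  StarAlgebra.adjoin ℂ (⋃ i, Set.range (pairHom π' hξ' π hξ i))

theorem pairHom_mem (hξ' : ∀ i, ‖ξ' i‖ = 1) (hξ : ∀ i, ‖ξ i‖ = 1) (i : ι) (a : A i) :
    pairHom π' hξ' π hξ i a ∈ pairAlgebra π' hξ' π hξ :=
  StarAlgebra.subset_adjoin ℂ _ (Set.mem_iUnion.2 ⟨i, a, rfl⟩)

/-- Linear statements about pairs need only be checked on words centered for the first family of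
states. -/
theorem pairAlgebra_induction (hξ' : ∀ i, ‖ξ' i‖ = 1) (hξ : ∀ i, ‖ξ i‖ = 1)
    (M : Submodule ℂ
      ((FreeHilbert ξ' →L[ℂ] FreeHilbert ξ') × (FreeHilbert ξ →L[ℂ] FreeHilbert ξ)))
    (h : ∀ l : List (Σ i, A i), IsAltCentered (fun i => vecState π' ξ' i) l →
      ((l.map fun p => leftAction ξ' p.1 (π' p.1 p.2)).prod,
        (l.map fun p => leftAction ξ p.1 (π p.1 p.2)).prod) ∈ M)
    {p} (hp : p ∈ pairAlgebra π' hξ' π hξ) : p ∈ M := by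
  refine Submodule.span_le.2 ?_ (starAdjoin_le_altSpan (vecState π' ξ') (vecState_one hξ') _ hp)
  rintro _ ⟨l, hl, rfl⟩
  rw [prod_pairHom]
  exact h l hl

variable (hξ' : ∀ i, ‖ξ' i‖ = 1) (hξ : ∀ i, ‖ξ i‖ = 1)
  (hst : ∀ i a, ⟪ξ i, π i a (ξ i)⟫_ℂ = ⟪ξ' i, π' i a (ξ' i)⟫_ℂ)

include hst

/-- Both vacuum functionals vanish on nonempty centered words, so they are determined by their
values at 1; the squared norms balance these values. -/
theorem inner_vacuum {f' : FreeHilbert ξ'} (hf' : SupportedOn [] f') {f : FreeHilbert ξ}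
    (hf : SupportedOn [] f) {p} (hp : p ∈ pairAlgebra π' hξ' π hξ) :
    ‖f'‖ ^ 2 * ⟪f, p.2 f⟫_ℂ = ‖f‖ ^ 2 * ⟪f', p.1 f'⟫_ℂ := by
  refine pairAlgebra_induction hξ' hξ (LinearMap.eqLocus
    ((‖f'‖ ^ 2 : ℂ) • ((innerSL ℂ f).toLinearMap ∘ₗ
      (ContinuousLinearMap.apply ℂ (FreeHilbert ξ) f).toLinearMap ∘ₗ LinearMap.snd ℂ _ _))
    ((‖f‖ ^ 2 : ℂ) • ((innerSL ℂ f').toLinearMap ∘ₗ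
      (ContinuousLinearMap.apply ℂ (FreeHilbert ξ') f').toLinearMap ∘ₗ LinearMap.fst ℂ _ _)))
    (fun l hl => ?_) hp
  change (‖f'‖ ^ 2 : ℂ) * ⟪f, (l.map fun p => leftAction ξ p.1 (π p.1 p.2)).prod f⟫_ℂ =
    (‖f‖ ^ 2 : ℂ) * ⟪f', (l.map fun p => leftAction ξ' p.1 (π' p.1 p.2)).prod f'⟫_ℂ
  by_cases hne : l = []
  · subst hne
    simp only [List.map_nil, List.prod_nil, one_apply_eq_self, inner_self_eq_norm_sq_to_K]
    exact mul_comm _ _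
  · have hch : (l.map Sigma.fst ++ []).IsChain (· ≠ ·) := by
      rw [List.append_nil]; exact hl.isChain
    have hne' : [] ≠ l.map Sigma.fst ++ [] := fun H =>
      hne (List.map_eq_nil_iff.1 (List.append_eq_nil_iff.1 H.symm).1)
    rw [hf.inner_eq_zero (hf.prod hξ (fun p hp => (hst p.1 p.2).trans (hl.centered p hp)) hch) hne',
      hf'.inner_eq_zero (hf'.prod hξ' hl.centered hch) hne', mul_zero, mul_zero]

/-- The compression of an element of the free product to `H_i` is given by an element of `A i`,
and this element also gives the compressions to `h ⊗ z` when `h` is orthogonal to the cyclic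
subspace of `ξ_i`. -/
theorem exists_compression (i : ι) (z' : WordSpace ξ' (emptyWord i).1.1) (w : AltWordNot i)
    (z : WordSpace ξ w.1.1) {h : H i} (hh : ∀ a, ⟪h, π i a (ξ i)⟫_ℂ = 0)
    {p} (hp : p ∈ pairAlgebra π' hξ' π hξ) :
    ∃ e : A i, (∀ g g' : H' i, ⟪place ξ' i (emptyWord i) z' g,
        p.1 (place ξ' i (emptyWord i) z' g')⟫_ℂ = ⟪g, π' i e g'⟫_ℂ * ⟪z', z'⟫_ℂ) ∧
      ⟪place ξ i w z h, p.2 (place ξ i w z h)⟫_ℂ = ⟪h, π i e h⟫_ℂ * ⟪z, z⟫_ℂ := by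
  let M : Submodule ℂ
      ((FreeHilbert ξ' →L[ℂ] FreeHilbert ξ') × (FreeHilbert ξ →L[ℂ] FreeHilbert ξ)) :=
    { carrier := {p | ∃ e : A i, (∀ g g' : H' i, ⟪place ξ' i (emptyWord i) z' g,
          p.1 (place ξ' i (emptyWord i) z' g')⟫_ℂ = ⟪g, π' i e g'⟫_ℂ * ⟪z', z'⟫_ℂ) ∧
        ⟪place ξ i w z h, p.2 (place ξ i w z h)⟫_ℂ = ⟪h, π i e h⟫_ℂ * ⟪z, z⟫_ℂ}
      zero_mem' := ⟨0, by simp⟩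
      add_mem' := by
        rintro p q ⟨e, he, he'⟩ ⟨d, hd, hd'⟩
        refine ⟨e + d, fun g g' => ?_, ?_⟩
        · simp [he, hd, add_mul]
        · simp [he', hd', add_mul]
      smul_mem' := by
        rintro c p ⟨e, he, he'⟩
        refine ⟨c • e, fun g g' => ?_, ?_⟩
        · simp [he, mul_assoc]
        · simp [he', mul_assoc] }
  refine pairAlgebra_induction hξ' hξ M (fun l hl => ?_) hp
  -- The orthogonal complement of the cyclic subspace is invariant, so applying the last letter of a
  -- word to h keeps it in H°_i.
  have hcen : ∀ a, π i a h ∈ Centered ξ i := fun a => by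
    rw [mem_centered_iff, ← inner_conj_symm, ← ContinuousLinearMap.adjoint_inner_right,
      ← ContinuousLinearMap.star_eq_adjoint, ← map_star, hh, map_zero]
  have hcen1 : h ∈ Centered ξ i := by simpa using hcen 1
  have hl' : ∀ p ∈ l, ⟪ξ p.1, π p.1 p.2 (ξ p.1)⟫_ℂ = 0 := fun p hp =>
    (hst p.1 p.2).trans (hl.centered p hp)
  -- Split by the last letter. The empty word has e = 1 and a single letter `a` from `A i` has e =
  -- a. Otherwise e = 0: a last letter from `A i` is absorbed into the first leg, and what remains
  -- is a nonempty word not ending with `i`.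
  rcases l.eq_nil_or_concat with rfl | ⟨l, ⟨k, a⟩, rfl⟩
  · refine ⟨1, fun g g' => ?_, ?_⟩
    · simp only [List.map_nil, List.prod_nil, one_apply_eq_self, map_one,
        inner_place_place ξ' i (hξ' i)]
    · simp only [List.map_nil, List.prod_nil, one_apply_eq_self, map_one,
        inner_place_place ξ i (hξ i)]
  rw [List.concat_eq_append] at *
  by_cases hki : k = i
  · subst hki
    by_cases hne : l = []
    · subst hne
      refine ⟨a, fun g g' => ?_, ?_⟩
      · simp [leftAction_place ξ' k (hξ' k), inner_place_place ξ' k (hξ' k)]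
      · simp [leftAction_place ξ k (hξ k), inner_place_place ξ k (hξ k)]
    · have hch := hl.isChain
      rw [List.map_append] at hch
      refine ⟨0, fun g g' => ?_, ?_⟩
      · simp only [List.map_append, List.map_cons, List.map_nil, List.prod_append,
          List.prod_singleton, mul_apply_eq_comp, leftAction_place ξ' k (hξ' k)]
        rw [inner_place_emptyWord_prod_place_eq_zero hξ' hl.of_append_left.centered hne hch]
        simp
      · simp only [List.map_append, List.map_cons, List.map_nil, List.prod_append,
          List.prod_singleton, mul_apply_eq_comp, leftAction_place ξ k (hξ k)]
        rw [inner_place_prod_place_eq_zero hξ (fun p hp => hl' p (List.mem_append_left _ hp)) hne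
          hch _ _ hcen1 (hcen a)]
        simp
  · have hch : ((l ++ [(⟨k, a⟩ : Σ i, A i)]).map Sigma.fst ++ [i]).IsChain (· ≠ ·) := by
      refine List.isChain_append.2 ⟨hl.isChain, List.isChain_singleton i, ?_⟩
      simpa using hki
    refine ⟨0, fun g g' => ?_, ?_⟩
    · exact (inner_place_emptyWord_prod_place_eq_zero hξ' hl.centered (by simp) hch _ _ _).trans
        (by simp)
    · exact (inner_place_prod_place_eq_zero hξ hl' (by simp) hch _ _ hcen1 hcen1).trans (by simp)

end Comparison

/-! ### Every vector is bounded -/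

section Comparison

universe u'

variable {ι : Type*} {A : ι → Type*} [∀ i, CStarAlgebra (A i)]
  {H' : ι → Type u'} [∀ i, NormedAddCommGroup (H' i)]
  [∀ i, InnerProductSpace ℂ (H' i)] [∀ i, CompleteSpace (H' i)]
  {H : ι → Type u} [∀ i, NormedAddCommGroup (H i)]
  [∀ i, InnerProductSpace ℂ (H i)] [∀ i, CompleteSpace (H i)]
  {π' : ∀ i, A i →⋆ₐ[ℂ] (H' i →L[ℂ] H' i)} {ξ' : ∀ i, H' i}
  {π : ∀ i, A i →⋆ₐ[ℂ] (H i →L[ℂ] H i)} {ξ : ∀ i, H i}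

/-- A unit vector in the word space of the empty word. -/
def wordUnit (ξ : ∀ i, H i) : WordSpace ξ [] :=
  (EuclideanSpace.single PUnit.unit 1 : EuclideanSpace ℂ PUnit.{u + 1})

omit [∀ i, CompleteSpace (H i)] in
theorem norm_wordUnit : ‖wordUnit ξ‖ = 1 := by
  change ‖(EuclideanSpace.single PUnit.unit 1 : EuclideanSpace ℂ PUnit.{u + 1})‖ = 1
  simp

variable (hξ' : ∀ i, ‖ξ' i‖ = 1) (hξ : ∀ i, ‖ξ i‖ = 1)
  (hst : ∀ i a, ⟪ξ i, π i a (ξ i)⟫_ℂ = ⟪ξ' i, π' i a (ξ' i)⟫_ℂ)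

include hst

theorem single_nil_mem_boundedVectors {f : FreeHilbert ξ} (hf : SupportedOn [] f) :
    f ∈ boundedVectors (pairAlgebra π' hξ' π hξ) := by
  classical
  let f' : FreeHilbert ξ' := lp.single 2 ⟨[], List.isChain_nil⟩ (wordUnit ξ')
  have hf' : ‖f'‖ = 1 := (lp.norm_single (by simp) _ _).trans norm_wordUnit
  refine mem_boundedVectors_of_inner (C := ‖f‖ ^ 2) fun p hp => ?_
  have key := inner_vacuum hξ' hξ hst (f' := f') (supportedOn_single ⟨[], List.isChain_nil⟩ _) hf hp
  rw [hf', Complex.ofReal_one, one_pow, one_mul] at key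
  rw [key, norm_mul, norm_pow, Complex.norm_real, norm_norm]
  gcongr
  refine (norm_inner_le_norm _ _).trans ?_
  rw [hf', one_mul]
  exact (p.1.le_opNorm f').trans_eq (by rw [hf', mul_one])

/-- The form of `p.2` at h ⊗ z is ⟪h, π_i(e) h⟫ ‖z‖², with e read off from the compression of `p.1`,
so it is controlled once ‖e‖ ≤ ‖p.1‖. -/
theorem place_mem_boundedVectors_of_orthogonal (hπ' : ∀ i, Function.Injective (π' i)) {i : ι}
    (w : AltWordNot i) (z : WordSpace ξ w.1.1) {h : H i} (hh : ∀ a, ⟪h, π i a (ξ i)⟫_ℂ = 0) :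
    place ξ i w z h ∈ boundedVectors (pairAlgebra π' hξ' π hξ) := by
  refine mem_boundedVectors_of_inner (C := ‖h‖ ^ 2 * ‖z‖ ^ 2) fun p hp => ?_
  obtain ⟨u, hu⟩ : ∃ u : WordSpace ξ' (emptyWord i).1.1, ‖u‖ = 1 := ⟨wordUnit ξ', norm_wordUnit⟩
  obtain ⟨e, he, he'⟩ := exists_compression hξ' hξ hst i u w z hh hp
  have hJ : ∀ g, ‖place ξ' i (emptyWord i) u g‖ = ‖g‖ := fun g => by
    rw [norm_place ξ' i (hξ' i), hu, mul_one]
  -- Faithfulness makes π'_i isometric, and g ↦ U_i(g ⊗ u) embeds H'_i isometrically, so compressing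
  -- to its range does not increase the norm.
  have hnorm : ‖e‖ ≤ ‖p.1‖ := by
    rw [← (NonUnitalStarAlgHom.isometry (π' i) (hπ' i)).norm_map_of_map_zero (map_zero _) e]
    refine ContinuousLinearMap.opNorm_le_bound _ (norm_nonneg _) fun g => ?_
    have h1 := he (π' i e g) g
    rw [inner_self_eq_norm_sq_to_K, inner_self_eq_norm_sq_to_K, hu] at h1
    have h2 : ‖π' i e g‖ ^ 2 ≤ ‖π' i e g‖ * (‖p.1‖ * ‖g‖) := by
      have h3 := norm_inner_le_norm (𝕜 := ℂ) (place ξ' i (emptyWord i) u (π' i e g))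
        (p.1 (place ξ' i (emptyWord i) u g))
      rw [h1, hJ] at h3
      refine le_trans ?_ (h3.trans (mul_le_mul_of_nonneg_left ((p.1.le_opNorm _).trans_eq ?_)
        (norm_nonneg _)))
      · simp
      · rw [hJ]
    rcases (norm_nonneg (π' i e g)).eq_or_lt with h0 | h0
    · rw [← h0]; positivity
    · rw [sq] at h2
      exact le_of_mul_le_mul_left h2 h0
  have hle : ‖π i e‖ ≤ ‖e‖ := NonUnitalStarAlgHom.norm_apply_le (π i) e
  rw [he', norm_mul, inner_self_eq_norm_sq_to_K, norm_pow]
  calc ‖⟪h, π i e h⟫_ℂ‖ * _ ≤ (‖h‖ * (‖p.1‖ * ‖h‖)) * ‖z‖ ^ 2 := by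
        gcongr
        · refine (norm_inner_le_norm _ _).trans ?_
          gcongr
          exact (π i e).le_of_opNorm_le (hle.trans hnorm) h
        · simp
    _ = _ := by ring

/-- H_i is the sum of the closed cyclic subspace R of ξ_i and its complement: invariance and
closedness handle R, the compression argument the rest. -/
theorem place_mem_boundedVectors (hπ' : ∀ i, Function.Injective (π' i)) {i : ι}
    (w : AltWordNot i) (z : WordSpace ξ w.1.1)
    (hz : place ξ i w z (ξ i) ∈ boundedVectors (pairAlgebra π' hξ' π hξ)) (h : H i) :
    place ξ i w z h ∈ boundedVectors (pairAlgebra π' hξ' π hξ) := by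
  let R : Submodule ℂ (H i) := LinearMap.range
    ((ContinuousLinearMap.apply ℂ (H i) (ξ i)).toLinearMap ∘ₗ (π i).toLinearMap)
  let N := (boundedVectors (pairAlgebra π' hξ' π hξ)).comap (place ξ i w z).toLinearMap
  have hN : IsClosed (N : Set (H i)) := isClosed_boundedVectors.preimage (place ξ i w z).continuous
  have hR : R.topologicalClosure ≤ N := by
    refine R.topologicalClosure_minimal ?_ hN
    rintro _ ⟨a, rfl⟩
    have := apply_mem_boundedVectors hz (pairHom_mem hξ' hξ i a)
    rwa [pairHom_apply, leftAction_place ξ i (hξ i)] at this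
  have hRo : R.topologicalClosureᗮ ≤ N := fun g hg =>
    place_mem_boundedVectors_of_orthogonal hξ' hξ hst hπ' w z fun a =>
      (Submodule.mem_orthogonal' _ _).1 hg _ (R.le_topologicalClosure ⟨a, rfl⟩)
  have htop := sup_le hR hRo
  rw [Submodule.sup_orthogonal_of_hasOrthogonalProjection] at htop
  exact htop (Submodule.mem_top (x := h))

/-- Induction on the word: its tail z is the placed vector ξ_i ⊗ z, from which h ⊗ z is reached for
all h. -/
theorem mem_boundedVectors (hπ' : ∀ i, Function.Injective (π' i)) (f : FreeHilbert ξ) :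
    f ∈ boundedVectors (pairAlgebra π' hξ' π hξ) := by
  classical
  suffices H : ∀ (w : List ι) (hw : w.IsChain (· ≠ ·)) (z : WordSpace ξ w),
      lp.single 2 (⟨w, hw⟩ : AltWord ι) z ∈ boundedVectors (pairAlgebra π' hξ' π hξ) from
    mem_of_single_mem _ isClosed_boundedVectors (fun w z => H w.1 w.2 z) f
  intro w
  induction w with
  | nil => exact fun hw z => single_nil_mem_boundedVectors hξ' hξ hst (supportedOn_single ⟨[], hw⟩ z)
  | cons i w ih =>
    intro hw t
    let w' : AltWordNot i := ⟨⟨w, hw.tail⟩, hw⟩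
    have key := mem_of_htmul_mem ((boundedVectors (pairAlgebra π' hξ' π hξ)).comap
      ((lp.singleContinuousLinearMap ℂ (fun v : AltWord ι => WordSpace ξ v.1) 2 w'.cons).comp
        ((wordCons ξ i w).toContinuousLinearEquiv :
          HTensor (Centered ξ i) (WordSpace ξ w) →L[ℂ] WordSpace ξ (i :: w))).toLinearMap)
      (isClosed_boundedVectors.preimage (ContinuousLinearMap.continuous _)) (fun h z => ?_)
      ((wordCons ξ i w).symm t)
    · simpa using key
    · have := place_mem_boundedVectors hξ' hξ hst hπ' w' z
        (by rw [place_distinguished ξ i w' z (hξ i)]; exact ih hw.tail z) h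
      rw [place_centered] at this
      simpa using this

theorem norm_snd_le_norm_fst (hπ' : ∀ i, Function.Injective (π' i)) {p}
    (hp : p ∈ pairAlgebra π' hξ' π hξ) : ‖p.2‖ ≤ ‖p.1‖ :=
  ContinuousLinearMap.opNorm_le_bound _ (norm_nonneg _) fun f =>
    (norm_apply_le_of_mem_boundedVectors (mem_boundedVectors hξ' hξ hst hπ' f) hp).trans_eq
      (mul_comm _ _)

end Comparison

/-! ### From norm domination to a star homomorphism -/

section Graph

variable {B C : Type*} [CStarAlgebra B] [CStarAlgebra C] (S : StarSubalgebra ℂ (B × C))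

/-- A star subalgebra of a product whose second coordinates are dominated in norm by the first ones
is the graph of a star homomorphism, up to closures. -/
theorem exists_starAlgHom_of_norm_snd_le (hS : ∀ p ∈ S, ‖p.2‖ ≤ ‖p.1‖)
    (B₀ : StarSubalgebra ℂ B) (C₀ : StarSubalgebra ℂ C)
    (hB : B₀ ≤ (S.map (StarAlgHom.fst ℂ B C)).topologicalClosure)
    (hC : IsClosed (C₀ : Set C)) (hSC : ∀ p ∈ S, p.2 ∈ C₀) :
    ∃ Ψ : B₀ →⋆ₐ[ℂ] C₀, ∀ p ∈ S, ∀ h : p.1 ∈ B₀, (Ψ ⟨p.1, h⟩ : C) = p.2 := by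
  have hcl : ∀ p ∈ S.topologicalClosure, ‖p.2‖ ≤ ‖p.1‖ := fun p hp =>
    closure_minimal (s := (S : Set (B × C))) (t := {p | ‖p.2‖ ≤ ‖p.1‖}) hS
      (isClosed_le continuous_snd.norm continuous_fst.norm) hp
  have huniq : ∀ b c c', (b, c) ∈ S.topologicalClosure → (b, c') ∈ S.topologicalClosure →
      c = c' := fun b c c' h h' => by
    have := hcl _ (sub_mem h h')
    simpa [sub_eq_zero] using this
  have hexists : ∀ b : B₀, ∃ c : C₀, ((b : B), (c : C)) ∈ S.topologicalClosure := by
    intro b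
    obtain ⟨x, hx, hxb⟩ := mem_closure_iff_seq_limit.1 (hB b.2)
    choose p hp hpx using hx
    -- Domination applied to differences makes second coordinates Cauchy whenever the first ones
    -- converge.
    have hcauchy : CauchySeq fun n => (p n).2 := by
      refine Metric.cauchySeq_iff'.2 fun ε hε => ?_
      obtain ⟨N, hN⟩ := Metric.cauchySeq_iff'.1 hxb.cauchySeq ε hε
      refine ⟨N, fun n hn => lt_of_le_of_lt ?_ (hN n hn)⟩
      rw [dist_eq_norm, dist_eq_norm, ← hpx, ← hpx]
      exact hS _ (sub_mem (hp n) (hp N))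
    obtain ⟨c, hc⟩ := cauchySeq_tendsto_of_complete hcauchy
    refine ⟨⟨c, hC.mem_of_tendsto hc (Filter.Eventually.of_forall fun n => hSC _ (hp n))⟩, ?_⟩
    refine mem_closure_of_tendsto (b := Filter.atTop) (f := p) ?_ (Filter.Eventually.of_forall hp)
    exact (hxb.congr fun n => (hpx n).symm).prodMk_nhds hc
  choose Ψ hΨ using hexists
  -- The closure of S is itself a star subalgebra and a graph, so each algebraic law for Ψ is a
  -- membership statement.
  have hval : ∀ (b : B₀) (c : C₀), ((b : B), (c : C)) ∈ S.topologicalClosure → Ψ b = c :=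
    fun b c h => Subtype.ext (huniq _ _ _ (hΨ b) h)
  refine ⟨{ toFun := Ψ
            map_one' := hval _ _ (one_mem S.topologicalClosure)
            map_mul' := fun b b' => hval _ _ (mul_mem (hΨ b) (hΨ b'))
            map_zero' := hval _ _ (zero_mem S.topologicalClosure)
            map_add' := fun b b' => hval _ _ (add_mem (hΨ b) (hΨ b'))
            commutes' := fun c => hval _ _ (algebraMap_mem S.topologicalClosure c)
            map_star' := fun b => hval _ _ (star_mem (hΨ b)) }, fun p hp h => ?_⟩
  exact congrArg Subtype.val
    (hval ⟨p.1, h⟩ ⟨p.2, hSC p hp⟩ (S.le_topologicalClosure hp))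

end Graph

/-! ### Uniqueness and existence on the reduced free product -/

section ReducedFreeProduct

universe u'

variable {ι : Type*} {A : ι → Type*} [∀ i, CStarAlgebra (A i)]
  {H : ι → Type u} [∀ i, NormedAddCommGroup (H i)]
  [∀ i, InnerProductSpace ℂ (H i)] [∀ i, CompleteSpace (H i)]
  (π : ∀ i, A i →⋆ₐ[ℂ] (H i →L[ℂ] H i)) {ξ : ∀ i, H i} (hξ : ∀ i, ‖ξ i‖ = 1)

theorem reducedFreeProduct_eq : reducedFreeProduct π ξ = (StarAlgebra.adjoin ℂ
    (⋃ i, Set.range ((leftActionHom ξ i (hξ i)).comp (π i)))).topologicalClosure := rfl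

variable (ξ) in
/-- The inclusion of the reduced free product in the bounded operators. -/
def toOp : ReducedFreeProduct π ξ →⋆ₐ[ℂ] (FreeHilbert ξ →L[ℂ] FreeHilbert ξ) :=
  (reducedFreeProduct π ξ).subtype

theorem isInducing_toOp : Topology.IsInducing (toOp π ξ) := Topology.IsInducing.subtypeVal

include hξ in
/-- A closed subspace of the reduced free product which contains all alternating products of
centered elements is the whole algebra. -/
theorem mem_of_prod_incl_mem (M : Submodule ℂ (ReducedFreeProduct π ξ))
    (hM : IsClosed (M : Set (ReducedFreeProduct π ξ)))
    (h : ∀ l : List (Σ i, A i), IsAltCentered (fun i => vecState π ξ i) l →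
      (l.map fun p => incl π ξ p.1 p.2).prod ∈ M) (x : ReducedFreeProduct π ξ) : x ∈ M := by
  have hle : (StarAlgebra.adjoin ℂ (⋃ i, Set.range ((leftActionHom ξ i (hξ i)).comp (π i))) :
      Set (FreeHilbert ξ →L[ℂ] FreeHilbert ξ)) ⊆ toOp π ξ '' M := by
    intro b hb
    refine (Submodule.span_le.2 ?_ : _ ≤ M.map (toOp π ξ).toLinearMap)
      (starAdjoin_le_altSpan (vecState π ξ) (vecState_one hξ) _ hb)
    rintro _ ⟨l, hl, rfl⟩
    refine ⟨_, h l hl, ?_⟩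
    refine (map_list_prod (toOp π ξ) _).trans ?_
    rw [List.map_map]
    rfl
  have hx : toOp π ξ x ∈ closure (toOp π ξ '' M) := closure_mono hle x.2
  rw [← Set.mem_preimage, ← (isInducing_toOp π).closure_eq_preimage_closure_image,
    hM.closure_eq] at hx
  exact hx

variable {A' : ι → Type*} [∀ i, CStarAlgebra (A' i)]
  {H' : ι → Type u'} [∀ i, NormedAddCommGroup (H' i)]
  [∀ i, InnerProductSpace ℂ (H' i)] [∀ i, CompleteSpace (H' i)]
  {π' : ∀ i, A' i →⋆ₐ[ℂ] (H' i →L[ℂ] H' i)} {ξ' : ∀ i, H' i} {π}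

theorem IsFreeProductMap.unique (hξ' : ∀ i, ‖ξ' i‖ = 1) {φ : ∀ i, A' i → A i}
    {Φ Φ' : CompletelyPositiveMap (ReducedFreeProduct π' ξ') (ReducedFreeProduct π ξ)}
    (h : IsFreeProductMap π' ξ' π ξ φ Φ) (h' : IsFreeProductMap π' ξ' π ξ φ Φ') : Φ = Φ' := by
  refine DFunLike.ext _ _ fun x => mem_of_prod_incl_mem π' hξ'
    (LinearMap.eqLocus (Φ : ReducedFreeProduct π' ξ' →ₗ[ℂ] ReducedFreeProduct π ξ)
      (Φ' : ReducedFreeProduct π' ξ' →ₗ[ℂ] ReducedFreeProduct π ξ))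
    (isClosed_eq (map_continuous Φ) (map_continuous Φ')) (fun l hl => ?_) x
  change Φ _ = Φ' _
  by_cases hne : l = []
  · subst hne
    rw [List.map_nil, List.prod_nil, h.map_one, h'.map_one]
  · rw [h.map_alternating l hne hl.isChain hl.centered,
      h'.map_alternating l hne hl.isChain hl.centered]
    simp only [h.map_incl, h'.map_incl]

/-- State preserving star homomorphisms of the factors extend to the reduced free product. -/
theorem exists_starAlgHom_reducedFreeProduct (hπ' : ∀ i, Function.Injective (π' i))
    (hξ' : ∀ i, ‖ξ' i‖ = 1) (hξ : ∀ i, ‖ξ i‖ = 1) (φ : ∀ i, A' i →⋆ₐ[ℂ] A i)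
    (hφ : ∀ i a, ⟪ξ i, π i (φ i a) (ξ i)⟫_ℂ = ⟪ξ' i, π' i a (ξ' i)⟫_ℂ) :
    ∃ Ψ : ReducedFreeProduct π' ξ' →⋆ₐ[ℂ] ReducedFreeProduct π ξ,
      ∀ i a, Ψ (incl π' ξ' i a) = incl π ξ i (φ i a) := by
  -- Composing with `φ i` lets the same `A' i` act on both sides; the hypothesis on states is
  -- exactly agreement of the two vector states.
  let S := pairAlgebra π' hξ' (fun i => (π i).comp (φ i)) hξ
  have hB : reducedFreeProduct π' ξ' ≤ (S.map (StarAlgHom.fst ℂ _ _)).topologicalClosure := by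
    rw [reducedFreeProduct_eq π' hξ']
    refine StarSubalgebra.topologicalClosure_mono (StarAlgebra.adjoin_le ?_)
    refine Set.iUnion_subset fun i => ?_
    rintro _ ⟨a, rfl⟩
    exact ⟨_, pairHom_mem hξ' hξ i a, rfl⟩
  have hC : S ≤ (reducedFreeProduct π ξ).comap (StarAlgHom.snd ℂ _ _) := by
    refine StarAlgebra.adjoin_le (Set.iUnion_subset fun i => ?_)
    rintro _ ⟨a, rfl⟩
    exact (incl π ξ i (φ i a)).2
  obtain ⟨Ψ, hΨ⟩ := exists_starAlgHom_of_norm_snd_le S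
    (fun p hp => norm_snd_le_norm_fst hξ' hξ hφ hπ' hp) _ _ hB
    (isClosed_reducedFreeProduct π ξ) fun p hp => hC hp
  exact ⟨Ψ, fun i a => Subtype.ext (hΨ _ (pairHom_mem hξ' hξ i a) (incl π' ξ' i a).2)⟩

theorem isFreeProductMap_of_starAlgHom {φ : ∀ i, A' i → A i}
    {Φ : CompletelyPositiveMap (ReducedFreeProduct π' ξ') (ReducedFreeProduct π ξ)}
    (Ψ : ReducedFreeProduct π' ξ' →⋆ₐ[ℂ] ReducedFreeProduct π ξ) (hΨ : ∀ x, Φ x = Ψ x)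
    (h : ∀ i a, Ψ (incl π' ξ' i a) = incl π ξ i (φ i a)) :
    IsFreeProductMap π' ξ' π ξ φ Φ where
  map_one := (hΨ 1).trans (map_one Ψ)
  map_incl i a := (hΨ _).trans (h i a)
  map_alternating l _ _ _ := by
    simp only [hΨ]
    rw [map_list_prod, List.map_map]
    rfl

end ReducedFreeProduct

end

end FreeProd

/-! ### The main theorem -/

theorem mainTheorem8 {n : ℕ}
    {A' A : Fin n → Type*} [∀ i, CStarAlgebra (A' i)] [∀ i, CStarAlgebra (A i)]
    {H' H : Fin n → Type*}
    [∀ i, NormedAddCommGroup (H' i)] [∀ i, InnerProductSpace ℂ (H' i)]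
    [∀ i, CompleteSpace (H' i)]
    [∀ i, NormedAddCommGroup (H i)] [∀ i, InnerProductSpace ℂ (H i)]
    [∀ i, CompleteSpace (H i)]
    (π' : ∀ i, A' i →⋆ₐ[ℂ] (H' i →L[ℂ] H' i)) (hπ' : ∀ i, Function.Injective (π' i))
    (π : ∀ i, A i →⋆ₐ[ℂ] (H i →L[ℂ] H i)) (hπ : ∀ i, Function.Injective (π i))
    (ξ' : ∀ i, H' i) (hξ' : ∀ i, ‖ξ' i‖ = 1)
    (ξ : ∀ i, H i) (hξ : ∀ i, ‖ξ i‖ = 1)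
    (φ : ∀ i, A' i →⋆ₐ[ℂ] A i)
    (hφ : ∀ (i : Fin n) (a : A' i),
      ⟪ξ i, π i (φ i a) (ξ i)⟫_ℂ = ⟪ξ' i, π' i a (ξ' i)⟫_ℂ) :
    (∃! Φ : CompletelyPositiveMap (FreeProd.ReducedFreeProduct π' ξ')
        (FreeProd.ReducedFreeProduct π ξ),
      FreeProd.IsFreeProductMap π' ξ' π ξ (fun i => φ i) Φ) ∧
    (∀ Φ : CompletelyPositiveMap (FreeProd.ReducedFreeProduct π' ξ')
        (FreeProd.ReducedFreeProduct π ξ),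
      FreeProd.IsFreeProductMap π' ξ' π ξ (fun i => φ i) Φ →
        ∃ Ψ : FreeProd.ReducedFreeProduct π' ξ' →⋆ₐ[ℂ] FreeProd.ReducedFreeProduct π ξ,
          ∀ x, Ψ x = Φ x) := by

  obtain ⟨Ψ, hΨ⟩ := FreeProd.exists_starAlgHom_reducedFreeProduct hπ' hξ' hξ φ hφ
  let Φ : CompletelyPositiveMap (FreeProd.ReducedFreeProduct π' ξ')
      (FreeProd.ReducedFreeProduct π ξ) :=
    CompletelyPositiveMapClass.toCompletelyPositiveLinearMap Ψ
  have hΦ : FreeProd.IsFreeProductMap π' ξ' π ξ (fun i => φ i) Φ :=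
    FreeProd.isFreeProductMap_of_starAlgHom Ψ (fun _ => rfl) hΨ
  -- A star homomorphism is completely positive, which gives existence; by uniqueness every other
  -- candidate coincides with it and is therefore multiplicative.
  exact ⟨⟨Φ, hΦ, fun Φ' h => h.unique hξ' hΦ⟩,
    fun Φ' h => ⟨Ψ, fun x => DFunLike.congr_fun (hΦ.unique hξ' h) x⟩⟩
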